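/- Throughout, $K$ is a field of characteristic $0$, graded vector spaces are $\mathbb Z$-graded over $K$, $\bar{\mathsf T}(V)=\bigoplus_{i\ge1}V^{\otimes i}$, $\varepsilon(\sigma)$ is the Koszul sign, $\mathbb S_{(p,q)}$ is the set of $(p,q)$-shuffles, and in exponents of $-1$ an element stands for its degree. For a graded vector space $V$ let $\mathrm{Hom}^n(\bar{\mathsf T}(V),V)$ be the space of linear maps $f=\sum_{i\ge1}f_i$, $f_i:V^{\otimes i}\to V$, of degree $n$. The graded Balavoine bracket on $\bigoplus_n\mathrm{Hom}^n(\bar{\mathsf T}(V),V)$ is $[f,g]_{\mathsf B}=f\,\bar\circ\,g-(-1)^{mn}g\,\bar\circ\,f$ for $f,g$ of degrees $m,n$, where $$(f_i\bar\circ g_j)(v_1,\dots,v_s)=\sum_{k=1}^{i}\sum_{\sigma\in\mathbb S_{(k-1,j-1)}}(-1)^{n(v_{\sigma(1)}+\cdots+v_{\sigma(k-1)})}\varepsilon(\sigma)\,f_i\big(v_{\sigma(1)},\dots,v_{\sigma(k-1)},g_j(v_{\sigma(k)},\dots,v_{\sigma(k+j-2)},v_{k+j-1}),v_{k+j},\dots,v_s\big),\quad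 s=i+j-1.$$ A Maurer–Cartan element is an element $\theta$ of degree $1$ with $[\theta,\theta]_{\mathsf B}=0$; a $\mathrm{Leibniz}_\infty$-algebra is a graded vector space $V$ with a Maurer–Cartan element $\theta=\sum_k\theta_k$. A homomorphism $(V,\theta)\to(V',\theta')$ of $\mathrm{Leibniz}_\infty$-algebras is a degree $0$ linear map $f=\sum_kf_k:\bar{\mathsf T}(V)\to V'$ such that $$\sum(-1)^{v_{\sigma(1)}+\cdots+v_{\sigma(k-1)}}\varepsilon(\sigma)f_{n-i+1}\big(v_{\sigma(1)},\dots,v_{\sigma(k-1)},\theta_i(v_{\sigma(k)},\dots,v_{\sigma(k+i-2)},v_{k+i-1}),v_{k+i},\dots,v_n\big)=\sum\varepsilon(\sigma)\theta'_p\big(f_{k_1}(v_{\sigma(1)},\dots),\dots,f_{k_p}(\dots,v_{\sigma(n)})\big)$$ for all $n\ge 1$ and homogeneous $v_1,\dots,v_n\in V$. The left sum is over $1\le i\le n$, $1\le k\le n-i+1$, $\sigma\in\mathbb S_{(k-1,i-1)}$; the right sum is over $p\ge 1$, $k_1+\cdots+k_p=n$ with all $k_j\ge 1$, and $(k_1,\dots,k_p)$-shuffles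 $\sigma$ with $\sigma(k_1)<\sigma(k_1+k_2)<\cdots<\sigma(n)$. The composite $g\circ f$ is $(g\circ f)_n(v_1,\dots,v_n)=\sum\varepsilon(\sigma)g_p(f_{k_1}(v_{\sigma(1)},\dots),\dots,f_{k_p}(\dots,v_{\sigma(n)}))$, with the same index set as the right sum. Let $(\mathfrak g,\{l_k\}_{k\ge1})$ be an $L_\infty$-algebra (graded symmetric brackets $l_k:\mathsf S^k(\mathfrak g)\to\mathfrak g$ of degree $1$ with $\sum_i\sum_{\sigma\in\mathbb S_{(i,n-i)}}\varepsilon(\sigma)\,l_{n-i+1}(l_i(x_{\sigma(1)},\dots,x_{\sigma(i)}),x_{\sigma(i+1)},\dots,x_{\sigma(n)})=0$) and $(V,\{\rho_k\}_{k\ge1})$ a representation (degree $1$ maps $\rho_k:\mathsf S^{k-1}(\mathfrak g)\otimes V\to V$ with $$\sum_{i=1}^{n-1}\sum_{\sigma\in\mathbb S_{(i,n-1-i)}}\varepsilon(\sigma)\rho_{n-i+1}(l_i(x_{\sigma(1)},\dots,x_{\sigma(i)}),x_{\sigma(i+1)},\dots,x_{\sigma(n-1)},v)+\sum_{i=0}^{n-1}\sum_{\sigma\in\mathbb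 S_{(i,n-1-i)}}(-1)^{x_{\sigma(1)}+\cdots+x_{\sigma(i)}}\varepsilon(\sigma)\rho_{i+1}(x_{\sigma(1)},\dots,x_{\sigma(i)},\rho_{n-i}(x_{\sigma(i+1)},\dots,x_{\sigma(n-1)},v))=0$$ for all $n\ge 1$). Define $\Delta=\sum_k l_k\boxplus\rho_k\in\mathrm{Hom}^1(\bar{\mathsf T}(\mathfrak g\oplus V),\mathfrak g\oplus V)$ by $$(l_k\boxplus\rho_k)\big((x_1,v_1),\dots,(x_k,v_k)\big)=\big(l_k(x_1,\dots,x_k),\rho_k(x_1,\dots,x_{k-1},v_k)\big).$$ Regard $\mathfrak h=\bigoplus_n\mathrm{Hom}^n(\bar{\mathsf T}(V),\mathfrak g)$ as a subspace of $\bigoplus_n\mathrm{Hom}^n(\bar{\mathsf T}(\mathfrak g\oplus V),\mathfrak g\oplus V)$ (extension by zero), and let $P$ be the projection onto $\mathfrak h$. The derived $L_\infty$-algebra is $\mathfrak h$ with brackets $\mathfrak l_k(a_1,\dots,a_k)=P[\cdots[[\Delta,a_1]_{\mathsf B},a_2]_{\mathsf B},\cdots,a_k]_{\mathsf B}$. A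 homotopy embedding tensor is a Maurer–Cartan element of it, i.e. a degree $0$ element $\Theta\in\mathfrak h$ with $\sum_{k\ge1}\frac1{k!}\mathfrak l_k(\Theta,\dots,\Theta)=0$. **Theorem.** (i) Let $\Theta$ be a homotopy embedding tensor on $\mathfrak g$ with respect to $V$. For every $X\in\bar{\mathsf T}(\mathfrak g\oplus V)$ only finitely many terms of $e^{[\cdot,\Theta]_{\mathsf B}}\Delta=\sum_n\frac1{n!}[\cdots[[\Delta,\Theta]_{\mathsf B},\Theta]_{\mathsf B},\cdots,\Theta]_{\mathsf B}$ are nonzero on $X$, and $e^{[\cdot,\Theta]_{\mathsf B}}\Delta$ is a Maurer–Cartan element of $\big(\bigoplus_n\mathrm{Hom}^n(\bar{\mathsf T}(\mathfrak g\oplus V),\mathfrak g\oplus V),[\cdot,\cdot]_{\mathsf B}\big)$. (ii) $e^{[\cdot,\Theta]_{\mathsf B}}\Delta$ maps $\bar{\mathsf T}(V)$ into $V$, and $\theta^\Theta_k(v_1,\dots,v_k)=\big(e^{[\cdot,\Theta]_{\mathsf B}}\Delta\big)(v_1,\dots,v_k)$ defines a $\mathrm{Leibniz}_\infty$-algebra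 structure $\theta^\Theta$ on $V$. (iii) Consider the category whose objects are homotopy embedding tensors $(\mathfrak g,V,\Theta)$ and whose morphisms $(\mathfrak g',V',\Theta')\to(\mathfrak g,V,\Theta)$ are strict homomorphisms: pairs of degree $0$ linear maps $\phi_{\mathfrak g}:\mathfrak g'\to\mathfrak g$, $\phi_V:V'\to V$ such that $\phi_{\mathfrak g}(l'_n(x_1,\dots,x_n))=l_n(\phi_{\mathfrak g}(x_1),\dots,\phi_{\mathfrak g}(x_n))$, $\phi_{\mathfrak g}(\Theta'_n(v_1,\dots,v_n))=\Theta_n(\phi_V(v_1),\dots,\phi_V(v_n))$ and $\phi_V(\rho'_n(x_1,\dots,x_{n-1},u))=\rho_n(\phi_{\mathfrak g}(x_1),\dots,\phi_{\mathfrak g}(x_{n-1}),\phi_V(u))$ for all $n\ge 1$. Then $S(\mathfrak g,V,\Theta)=(V,\theta^\Theta)$ and $S(\phi_{\mathfrak g},\phi_V)=(\phi_V,0,0,\dots)$ define a functor $S$ from this category to the category of $\mathrm{Leibniz}_\infty$-algebras and their homomorphisms. -/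

import Mathlib

open scoped TensorProduct DirectSum
universe w u v

/-- A `ℤ`-graded vector space over `K`: a vector space with an internal direct sum decomposition
`⨁_{d ∈ ℤ} piece d`. -/
structure GradedSpace (K : Type w) [Field K] where
  carrier : Type u
  [addCommGroup : AddCommGroup carrier]
  [module : Module K carrier]
  piece : ℤ → Submodule K carrier
  isInternal : DirectSum.IsInternal piece

namespace GradedSpace

attribute [instance] GradedSpace.addCommGroup GradedSpace.module

variable {K : Type w} [Field K]

instance : CoeSort (GradedSpace.{w, u} K) (Type u) := ⟨GradedSpace.carrier⟩

/-- Elements of a graded space decompose into homogeneous ones. -/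
theorem piece_induction (V : GradedSpace.{w, u} K) {p : V → Prop} (h0 : p 0)
    (hadd : ∀ x y, p x → p y → p (x + y)) (h : ∀ d, ∀ x ∈ V.piece d, p x) (x : V) : p x := by
  have hx : x ∈ ⨆ d, V.piece d := by
    rw [V.isInternal.submodule_iSup_eq_top]; trivial
  exact Submodule.iSup_induction V.piece (motive := p) hx h h0 hadd

/-- The direct sum of two graded spaces, graded by `(V ⊕ W)^d = V^d ⊕ W^d`. -/
def prod (V : GradedSpace.{w, u} K) (W : GradedSpace.{w, v} K) : GradedSpace.{w, max u v} K where
  carrier := V × W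
  piece d := (V.piece d).prod (W.piece d)
  isInternal := by
    apply DirectSum.isInternal_submodule_of_iSupIndep_of_iSup_eq_top
    · have hV := V.isInternal.submodule_iSupIndep
      have hW := W.isInternal.submodule_iSupIndep
      intro d
      have h1 := hV d
      have h2 := hW d
      rw [Submodule.disjoint_def] at h1 h2 ⊢
      rintro ⟨a, b⟩ hab hs
      have hs' : (a, b) ∈ (⨆ j, ⨆ (_ : j ≠ d), V.piece j).prod (⨆ j, ⨆ (_ : j ≠ d), W.piece j) := by
        refine (iSup₂_le fun j hj => ?_ :
          (⨆ j, ⨆ (_ : j ≠ d), (V.piece j).prod (W.piece j)) ≤ _) hs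
        exact Submodule.prod_mono (le_iSup₂_of_le j hj le_rfl) (le_iSup₂_of_le j hj le_rfl)
      exact Prod.ext (h1 a hab.1 hs'.1) (h2 b hab.2 hs'.2)
    · rw [eq_top_iff]
      rintro ⟨a, b⟩ -
      have ha : ((a, 0) : V × W) ∈ ⨆ d, (V.piece d).prod (W.piece d) := by
        induction a using V.piece_induction with
        | h0 => exact zero_mem _
        | hadd x y hx hy => simpa using add_mem hx hy
        | h d x hx => exact Submodule.mem_iSup_of_mem d ⟨hx, zero_mem _⟩
      have hb : ((0, b) : V × W) ∈ ⨆ d, (V.piece d).prod (W.piece d) := by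
        induction b using W.piece_induction with
        | h0 => exact zero_mem _
        | hadd x y hx hy => simpa using add_mem hx hy
        | h d x hx => exact Submodule.mem_iSup_of_mem d ⟨zero_mem _, hx⟩
      simpa using add_mem ha hb

/-- The parity operator `v ↦ (-1)^{|v|} v` of a graded space. -/
noncomputable def parity (V : GradedSpace.{w, u} K) : V →ₗ[K] V :=
  DirectSum.toModule K ℤ V (fun d => ((-1 : K) ^ d) • (V.piece d).subtype) ∘ₗ
    (LinearEquiv.ofBijective (DirectSum.coeLinearMap V.piece) V.isInternal).symm.toLinearMap

theorem parity_apply (V : GradedSpace.{w, u} K) {d : ℤ} {x : V} (hx : x ∈ V.piece d) :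
    V.parity x = (-1 : K) ^ d • x := by
  have h : (LinearEquiv.ofBijective (DirectSum.coeLinearMap V.piece) V.isInternal).symm x
      = DirectSum.lof K ℤ (fun d => V.piece d) d ⟨x, hx⟩ := by
    rw [LinearEquiv.symm_apply_eq]
    exact (DirectSum.coeLinearMap_of V.piece d ⟨x, hx⟩).symm
  rw [parity, LinearMap.comp_apply, LinearEquiv.coe_coe, h, DirectSum.toModule_lof]
  rfl

theorem parity_parity (V : GradedSpace.{w, u} K) (x : V) : V.parity (V.parity x) = x := by
  induction x using V.piece_induction with
  | h0 => simp
  | hadd x y hx hy => simp [hx, hy]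
  | h d x hx =>
    rw [V.parity_apply hx, map_smul, V.parity_apply hx, smul_smul, ← mul_zpow]
    simp

/-- The tensor algebra `T(V) = ⨁_{i ≥ 0} V^{⊗ i}`. Elements of `Hom(T̄(V), W)`, where
`T̄(V) = ⨁_{i ≥ 1} V^{⊗ i}`, are encoded as linear maps `f : T(V) → W` with `f 1 = 0`; the component
`f_i` is the restriction of `f` to words of length `i`. -/
abbrev T (V : GradedSpace.{w, u} K) : Type (max w u) := TensorAlgebra K V

/-- The inclusion of letters `V → T(V)`. -/
noncomputable abbrev letter (V : GradedSpace.{w, u} K) : V →ₗ[K] V.T := TensorAlgebra.ι K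

/-- The map `T(V) → T(W)`, `v₁ ⊗ ⋯ ⊗ vₙ ↦ φ v₁ ⊗ ⋯ ⊗ φ vₙ` induced by a linear map `φ`. -/
noncomputable def tmap {V : GradedSpace.{w, u} K} {W : GradedSpace.{w, v} K} (φ : V →ₗ[K] W) :
    V.T →ₗ[K] W.T :=
  (TensorAlgebra.lift K (W.letter ∘ₗ φ)).toLinearMap

/-- The span of the words `v₁ ⊗ ⋯ ⊗ vₖ` in homogeneous letters of total degree `n`. -/
def words (V : GradedSpace.{w, u} K) (n : ℤ) : Submodule K V.T :=
  Submodule.span K {x | ∃ L : List (ℤ × V), (∀ a ∈ L, a.2 ∈ V.piece a.1) ∧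
    (L.map Prod.fst).sum = n ∧ x = (L.map fun a => V.letter a.2).prod}

/-- `f` belongs to `Hom^m(T̄(V), W)`, the linear maps of degree `m`. -/
structure IsCochain (V : GradedSpace.{w, u} K) (W : GradedSpace.{w, v} K) (m : ℤ)
    (f : V.T →ₗ[K] W) : Prop where
  map_one : f 1 = 0
  map_words : ∀ n : ℤ, ∀ x ∈ V.words n, f x ∈ W.piece (n + m)

section Words

variable (V : GradedSpace.{w, u} K) {S M : Type*} [AddCommMonoid S] [Module K S]
  [AddCommMonoid M] [Module K M]

/-- Reading a word from left to right: the linear map `T(V) → S` with `1 ↦ s₀` and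
`X ⊗ v ↦ step v (image of X)`. -/
noncomputable def foldWord (step : V →ₗ[K] S →ₗ[K] S) (s₀ : S) : V.T →ₗ[K] S where
  toFun x := (TensorAlgebra.lift K
    ((MulOpposite.opLinearEquiv K : Module.End K S ≃ₗ[K] _).toLinearMap ∘ₗ step) x).unop s₀
  map_add' x y := by simp
  map_smul' c x := by simp

variable {V}

@[simp] theorem foldWord_one (step : V →ₗ[K] S →ₗ[K] S) (s₀ : S) :
    V.foldWord step s₀ 1 = s₀ := by
  simp [foldWord]

@[simp] theorem foldWord_mul (step : V →ₗ[K] S →ₗ[K] S) (s₀ : S) (X : V.T) (x : V) :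
    V.foldWord step s₀ (X * V.letter x) = step x (V.foldWord step s₀ X) := by
  simp [foldWord]

/-- A subspace of `T(V)` that contains `1` and is closed under appending letters is everything. -/
theorem eq_top_of_mul_letter (P : Submodule K V.T) (h1 : 1 ∈ P)
    (h : ∀ X ∈ P, ∀ x, X * V.letter x ∈ P) : P = ⊤ := by
  have key : ∀ y : V.T, ∀ x ∈ P, x * y ∈ P := by
    intro y
    induction y using TensorAlgebra.induction with
    | algebraMap r =>
      intro x hx
      rw [← Algebra.commutes, ← Algebra.smul_def]
      exact P.smul_mem r hx
    | ι a => exact fun x hx => h x hx a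
    | mul a b ha hb => intro x hx; rw [← mul_assoc]; exact hb _ (ha _ hx)
    | add a b ha hb => intro x hx; rw [mul_add]; exact P.add_mem (ha _ hx) (hb _ hx)
  rw [eq_top_iff]
  intro y _
  simpa using key y 1 h1

theorem ext_letter {f g : V.T →ₗ[K] S} (h1 : f 1 = g 1)
    (h : ∀ X x, f X = g X → f (X * V.letter x) = g (X * V.letter x)) : f = g := by
  have := eq_top_of_mul_letter (LinearMap.eqLocus f g) h1 (fun X hX x => h X x hX)
  ext x
  have hx : x ∈ LinearMap.eqLocus f g := by rw [this]; trivial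
  exact hx

/-- The linear map `T(V) → M` with `1 ↦ 0` and `X ⊗ v ↦ φ X v`. -/
noncomputable def onLast (φ : V.T →ₗ[K] V →ₗ[K] M) : V.T →ₗ[K] M :=
  LinearMap.snd K V.T M ∘ₗ V.foldWord (S := V.T × M)
    (LinearMap.mk₂ K (fun x s => (s.1 * V.letter x, φ s.1 x))
      (by intros; simp [mul_add]) (by intros; simp)
      (by intros; simp [add_mul]) (by intros; simp)) (1, 0)

theorem onLast_aux (φ : V.T →ₗ[K] V →ₗ[K] M) (X : V.T) :
    (V.foldWord (S := V.T × M)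
    (LinearMap.mk₂ K (fun x s => (s.1 * V.letter x, φ s.1 x))
      (by intros; simp [mul_add]) (by intros; simp)
      (by intros; simp [add_mul]) (by intros; simp)) (1, 0) X).1 = X := by
  refine LinearMap.congr_fun (f := LinearMap.fst K V.T M ∘ₗ V.foldWord _ _)
    (g := LinearMap.id) (ext_letter ?_ ?_) X
  · simp
  · intro X x h
    simp only [LinearMap.comp_apply, LinearMap.fst_apply, LinearMap.id_apply] at h ⊢
    rw [foldWord_mul]
    simp [h]

@[simp] theorem onLast_one (φ : V.T →ₗ[K] V →ₗ[K] M) : onLast φ 1 = 0 := by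
  simp [onLast]

@[simp] theorem onLast_mul (φ : V.T →ₗ[K] V →ₗ[K] M) (X : V.T) (x : V) :
    onLast φ (X * V.letter x) = φ X x := by
  rw [onLast, LinearMap.comp_apply, foldWord_mul]
  simp only [LinearMap.mk₂_apply, LinearMap.snd_apply]
  rw [onLast_aux]

end Words

section Tmap

variable {V : GradedSpace.{w, u} K}

@[simp] theorem tmap_one {W : GradedSpace.{w, v} K} (φ : V →ₗ[K] W) : tmap φ (1 : V.T) = 1 := by
  simp [tmap]

@[simp] theorem tmap_mul {W : GradedSpace.{w, v} K} (φ : V →ₗ[K] W) (X Y : V.T) :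
    tmap φ (X * Y) = tmap φ X * tmap φ Y := by
  simp [tmap]

@[simp] theorem tmap_letter {W : GradedSpace.{w, v} K} (φ : V →ₗ[K] W) (x : V) :
    tmap φ (V.letter x) = W.letter (φ x) := by
  simp [tmap]

theorem tmap_id (X : V.T) : tmap (LinearMap.id : V →ₗ[K] V) X = X := by
  refine LinearMap.congr_fun (f := tmap LinearMap.id) (g := LinearMap.id)
    (ext_letter (by simp) ?_) X
  intro X x h
  rw [tmap_mul, h]
  simp

theorem tmap_comp {W Z : GradedSpace.{w, v} K} (ψ : W →ₗ[K] Z) (φ : V →ₗ[K] W) (X : V.T) :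
    tmap (ψ ∘ₗ φ) X = tmap ψ (tmap φ X) := by
  refine LinearMap.congr_fun (f := tmap (ψ ∘ₗ φ)) (g := tmap ψ ∘ₗ tmap φ)
    (ext_letter (by simp) ?_) X
  intro X x h
  simp only [LinearMap.comp_apply] at h
  rw [tmap_mul, h]
  simp

end Tmap

section Shuffles

variable (V : GradedSpace.{w, u} K)

/-- The projection `T(V) → K` onto the words of length zero. -/
noncomputable abbrev counit : V.T →ₐ[K] K := TensorAlgebra.algebraMapInv

/-- The projections of `V` onto its even and odd parts. -/
noncomputable def evenPart : V →ₗ[K] V := (2⁻¹ : K) • (LinearMap.id + V.parity)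

noncomputable def oddPart : V →ₗ[K] V := (2⁻¹ : K) • (LinearMap.id - V.parity)

/-- The parity operator `X ↦ (-1)^{|X|} X` of `T(V)`. -/
noncomputable def tparity : V.T →ₗ[K] V.T := tmap V.parity

/-- The operator `X ↦ (-1)^{n |X|} X` of `T(V)`. -/
noncomputable def tsign (n : ℤ) : V.T →ₗ[K] V.T := if Even n then LinearMap.id else V.tparity

/-- Right multiplication by a letter. -/
noncomputable def mulLetter : V →ₗ[K] V.T →ₗ[K] V.T :=
  (LinearMap.mul K V.T).flip ∘ₗ V.letter

/-- Right multiplication by `v ⊗ 1 + 1 ⊗ v` in the graded tensor product `T(V) ⊗ T(V)`: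
`X ⊗ Y ↦ (-1)^{|v||Y|} (X ⊗ v) ⊗ Y + X ⊗ (Y ⊗ v)`. -/
noncomputable def coshuffleStep : V →ₗ[K] (V.T ⊗[K] V.T) →ₗ[K] (V.T ⊗[K] V.T) where
  toFun v := TensorProduct.map (V.mulLetter (V.evenPart v)) LinearMap.id +
    TensorProduct.map (V.mulLetter (V.oddPart v)) V.tparity +
    TensorProduct.map LinearMap.id (V.mulLetter v)
  map_add' v v' := by
    simp only [map_add, TensorProduct.map_add_left, TensorProduct.map_add_right]; abel
  map_smul' c v := by
    simp only [map_smul, TensorProduct.map_smul_left, TensorProduct.map_smul_right, smul_add,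
      RingHom.id_apply]

/-- The graded coshuffle coproduct
`v₁ ⊗ ⋯ ⊗ vₙ ↦ ∑_{i} ∑_{σ ∈ S_{(i, n-i)}} ε(σ) (v_{σ(1)} ⊗ ⋯ ⊗ v_{σ(i)}) ⊗ (v_{σ(i+1)} ⊗ ⋯ ⊗ v_{σ(n)})`,
that is, the morphism of graded algebras `T(V) → T(V) ⊗ T(V)` with `v ↦ v ⊗ 1 + 1 ⊗ v`. -/
noncomputable def coshuffle : V.T →ₗ[K] V.T ⊗[K] V.T := V.foldWord V.coshuffleStep (1 ⊗ₜ 1)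

/-- The part of the coshuffle coproduct in which the last letter stays on the right:
`v₁ ⊗ ⋯ ⊗ vₙ ↦ ∑_{i < n} ∑_{σ ∈ S_{(i, n-1-i)}} ε(σ) (v_{σ(1)} ⊗ ⋯ ⊗ v_{σ(i)}) ⊗
  (v_{σ(i+1)} ⊗ ⋯ ⊗ v_{σ(n-1)} ⊗ vₙ)`, and `1 ↦ 0`. -/
noncomputable def halfCoshuffle : V.T →ₗ[K] V.T ⊗[K] V.T :=
  onLast ((LinearMap.lTensorHom V.T ∘ₗ V.mulLetter).flip ∘ₗ V.coshuffle)

end Shuffles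

/-- Sums of pointwise finite families of linear maps. -/
def PointwiseFinite {M N : Type*} [AddCommGroup M] [Module K M] [AddCommGroup N] [Module K N]
    (a : ℕ → M →ₗ[K] N) : Prop :=
  ∀ x, (Function.support fun n => a n x).Finite

open Classical in
/-- The sum `x ↦ ∑ₙ aₙ x` of a pointwise finite family of linear maps
(and `0` if the family is not pointwise finite). -/
noncomputable def pointwiseSum {M N : Type*} [AddCommGroup M] [Module K M] [AddCommGroup N]
    [Module K N] (a : ℕ → M →ₗ[K] N) : M →ₗ[K] N :=
  if h : PointwiseFinite a then
    { toFun := fun x => ∑ᶠ n, a n x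
      map_add' := fun x y => by
        rw [← finsum_add_distrib (h x) (h y)]
        simp
      map_smul' := fun c x => by
        simp [smul_finsum' c (h x)] }
  else 0

section Balavoine

variable (V : GradedSpace.{w, u} K)

/-- `g` applied inside a word, as its last entry: for `g` of degree `n`,
`v₁ ⊗ ⋯ ⊗ vₘ ↦ ∑ (-1)^{n(v_{σ(1)} + ⋯ + v_{σ(k-1)})} ε(σ)
  v_{σ(1)} ⊗ ⋯ ⊗ v_{σ(k-1)} ⊗ g(v_{σ(k)}, …, v_{σ(m-1)}, vₘ)`,
the sum being over `1 ≤ k ≤ m` and `σ ∈ S_{(k-1, m-k)}`. -/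
noncomputable def insertLast (n : ℤ) (g : V.T →ₗ[K] V) : V.T →ₗ[K] V.T :=
  LinearMap.mul' K V.T ∘ₗ TensorProduct.map (V.tsign n) (V.letter ∘ₗ g) ∘ₗ V.halfCoshuffle

/-- `g` applied inside a word: for `g` of degree `n`,
`v₁ ⊗ ⋯ ⊗ vₛ ↦ ∑_{m ≤ s} insertLast g (v₁ ⊗ ⋯ ⊗ vₘ) ⊗ v_{m+1} ⊗ ⋯ ⊗ vₛ`. That is, `1 ↦ 0` and
`X ⊗ v ↦ (image of X) ⊗ v + insertLast g (X ⊗ v)`. -/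
noncomputable def insertion (n : ℤ) (g : V.T →ₗ[K] V) : V.T →ₗ[K] V.T :=
  LinearMap.snd K V.T V.T ∘ₗ V.foldWord (S := V.T × V.T)
    (LinearMap.mk₂ K (fun v s => (s.1 * V.letter v,
        s.2 * V.letter v + V.insertLast n g (s.1 * V.letter v)))
      (by intros; simp [mul_add]; abel) (by intros; simp)
      (by intros; simp [add_mul]; abel) (by intros; simp)) (1, 0)

/-- The product `f ∘̄ g` of `f` with an element `g` of degree `n`:
`(fᵢ ∘̄ gⱼ)(v₁, …, vₛ) = ∑_{k=1}^{i} ∑_{σ ∈ S_{(k-1,j-1)}} (-1)^{n(v_{σ(1)} + ⋯ + v_{σ(k-1)})} ε(σ)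
  fᵢ(v_{σ(1)}, …, v_{σ(k-1)}, gⱼ(v_{σ(k)}, …, v_{σ(k+j-2)}, v_{k+j-1}), v_{k+j}, …, vₛ)`
for `s = i + j - 1`. -/
noncomputable def circ (n : ℤ) (f g : V.T →ₗ[K] V) : V.T →ₗ[K] V := f ∘ₗ V.insertion n g

/-- The graded Balavoine bracket `[f, g]_B = f ∘̄ g - (-1)^{mn} g ∘̄ f` of `f ∈ Hom^m(T̄(V), V)` and
`g ∈ Hom^n(T̄(V), V)`. -/
noncomputable def balavoine (m n : ℤ) (f g : V.T →ₗ[K] V) : V.T →ₗ[K] V :=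
  V.circ n f g - (-1 : K) ^ (m * n) • V.circ m g f

/-- Maurer-Cartan elements of the graded Lie algebra `(⨁ₘ Hom^m(T̄(V), V), [·,·]_B)`. -/
structure IsMaurerCartan (θ : V.T →ₗ[K] V) : Prop where
  isCochain : IsCochain V V 1 θ
  bracket_self : V.balavoine 1 1 θ θ = 0

/-- `f` factors through the graded symmetric algebra
`S(V) = T(V) / (x ⊗ y - (-1)^{xy} y ⊗ x)`. -/
def IsGradedSymmetric {M : Type*} [AddCommGroup M] [Module K M] (f : V.T →ₗ[K] M) : Prop :=
  ∀ i j : ℤ, ∀ x ∈ V.piece i, ∀ y ∈ V.piece j, ∀ X Y : V.T,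
    f (X * (V.letter x * V.letter y) * Y) = (-1 : K) ^ (i * j) • f (X * (V.letter y * V.letter x) * Y)

/-- `x₁ ⊗ ⋯ ⊗ xₙ ↦ ∑_{i} ∑_{σ ∈ S_{(i,n-i)}} ε(σ)
  l(x_{σ(1)}, …, x_{σ(i)}) ⊗ x_{σ(i+1)} ⊗ ⋯ ⊗ x_{σ(n)}`. -/
noncomputable def shuffleInsert (l : V.T →ₗ[K] V) : V.T →ₗ[K] V.T :=
  LinearMap.mul' K V.T ∘ₗ TensorProduct.map (V.letter ∘ₗ l) LinearMap.id ∘ₗ V.coshuffle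

end Balavoine

section Bar

/-- `∑_{k₁ + ⋯ + k_p = n} ∑_{σ ∈ E_{(k₁, …, k_p)}} ε(σ) f_{k₁}(v_{σ(1)}, …) ⊗ ⋯ ⊗ f_{k_p}(…, v_{σ(n)})`
on words `v₁ ⊗ ⋯ ⊗ vₙ`: the sum over all ways to distribute the letters over `p` nonempty blocks
that are ordered by their last letters. The last block contains `vₙ`, whence the recursion. -/
noncomputable def barPart {V : GradedSpace.{w, u} K} {W : GradedSpace.{w, v} K}
    (f : V.T →ₗ[K] W) : ℕ → V.T →ₗ[K] W.T
  | 0 => Algebra.linearMap K W.T ∘ₗ V.counit.toLinearMap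
  | p + 1 => LinearMap.mul' K W.T ∘ₗ TensorProduct.map (barPart f p) (W.letter ∘ₗ f) ∘ₗ
      V.halfCoshuffle

/-- `v₁ ⊗ ⋯ ⊗ vₙ ↦ ∑_{p} ∑_{k₁ + ⋯ + k_p = n} ∑_{σ ∈ E_{(k₁, …, k_p)}} ε(σ)
  f_{k₁}(v_{σ(1)}, …) ⊗ ⋯ ⊗ f_{k_p}(…, v_{σ(n)})`. -/
noncomputable def barMap {V : GradedSpace.{w, u} K} {W : GradedSpace.{w, v} K}
    (f : V.T →ₗ[K] W) : V.T →ₗ[K] W.T := pointwiseSum (barPart f)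

end Bar

end GradedSpace

open GradedSpace

/-- `L_∞`-algebras, with graded symmetric brackets `l_k` of degree `1`. -/
structure LInfinityAlgebra (K : Type w) [Field K] where
  space : GradedSpace.{w, u} K
  l : space.T →ₗ[K] space
  isCochain : IsCochain space space 1 l
  symm : space.IsGradedSymmetric l
  /-- The generalized Jacobi identities
  `∑_{i} ∑_{σ ∈ S_{(i,n-i)}} ε(σ) l_{n-i+1}(l_i(x_{σ(1)}, …, x_{σ(i)}), x_{σ(i+1)}, …) = 0`. -/
  jacobi : l ∘ₗ space.shuffleInsert l = 0

/-- Representations of an `L_∞`-algebra `𝔤` on a graded space `V`: the map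
`ρ_k : S^{k-1}(𝔤) ⊗ V → V` is `(x₁ ⊗ ⋯ ⊗ x_{k-1}) ⊗ v ↦ ρ (x₁ ⊗ ⋯ ⊗ x_{k-1}) v`. -/
structure LInfinityAlgebra.Representation {K : Type w} [Field K] (𝔤 : LInfinityAlgebra.{w, u} K)
    (V : GradedSpace.{w, v} K) where
  ρ : 𝔤.space.T →ₗ[K] Module.End K V
  degree : ∀ n d : ℤ, ∀ X ∈ 𝔤.space.words n, ∀ v ∈ V.piece d, ρ X v ∈ V.piece (n + d + 1)
  symm : 𝔤.space.IsGradedSymmetric ρ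
  /-- For homogeneous `x₁, …, x_{n-1} ∈ 𝔤` and `v ∈ V`,
  `∑_{i} ∑_{σ ∈ S_{(i,n-1-i)}} ε(σ) ρ_{n-i+1}(l_i(x_{σ(1)}, …, x_{σ(i)}), x_{σ(i+1)}, …, x_{σ(n-1)}, v)
  + ∑_{i} ∑_{σ ∈ S_{(i,n-1-i)}} (-1)^{x_{σ(1)} + ⋯ + x_{σ(i)}} ε(σ)
  ρ_{i+1}(x_{σ(1)}, …, x_{σ(i)}, ρ_{n-i}(x_{σ(i+1)}, …, x_{σ(n-1)}, v)) = 0`. -/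
  action : ρ ∘ₗ 𝔤.space.shuffleInsert 𝔤.l + LinearMap.mul' K (Module.End K V) ∘ₗ
    TensorProduct.map (ρ ∘ₗ 𝔤.space.tparity) ρ ∘ₗ 𝔤.space.coshuffle = 0

namespace LInfinityAlgebra.Representation

variable {K : Type w} [Field K] {𝔤 : LInfinityAlgebra.{w, u} K} {V : GradedSpace.{w, v} K}

/-- `𝔤 ⊕ V`. -/
abbrev total (_ : 𝔤.Representation V) : GradedSpace.{w, max u v} K := 𝔤.space.prod V

/-- The element `∑_k l_k ⊞ ρ_k` of `Hom¹(T̄(𝔤 ⊕ V), 𝔤 ⊕ V)`, given by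
`(l_k ⊞ ρ_k)((x₁, v₁), …, (x_k, v_k)) = (l_k(x₁, …, x_k), ρ_k(x₁, …, x_{k-1}, v_k))`. -/
noncomputable def hemisemidirect (r : 𝔤.Representation V) : r.total.T →ₗ[K] r.total :=
  LinearMap.inl K 𝔤.space V ∘ₗ 𝔤.l ∘ₗ tmap (V := r.total) (LinearMap.fst K 𝔤.space V) +
  LinearMap.inr K 𝔤.space V ∘ₗ onLast (V := r.total)
    (((r.ρ ∘ₗ tmap (V := r.total) (LinearMap.fst K 𝔤.space V)).flip ∘ₗ
      LinearMap.snd K 𝔤.space V).flip)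

/-- The horizontal lift of `a ∈ Hom(T̄(V), 𝔤)` to `Hom(T̄(𝔤 ⊕ V), 𝔤 ⊕ V)`:
`((x₁, v₁), …, (xₙ, vₙ)) ↦ (a(v₁, …, vₙ), 0)`. -/
noncomputable def horizontalLift (r : 𝔤.Representation V) (a : V.T →ₗ[K] 𝔤.space) :
    r.total.T →ₗ[K] r.total :=
  LinearMap.inl K 𝔤.space V ∘ₗ a ∘ₗ tmap (V := r.total) (LinearMap.snd K 𝔤.space V)

/-- The projection of `Hom(T̄(𝔤 ⊕ V), 𝔤 ⊕ V)` onto `𝔥 = Hom(T̄(V), 𝔤)`. -/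
noncomputable def proj (r : 𝔤.Representation V) (f : r.total.T →ₗ[K] r.total) :
    V.T →ₗ[K] 𝔤.space :=
  LinearMap.fst K 𝔤.space V ∘ₗ f ∘ₗ tmap (W := r.total) (LinearMap.inr K 𝔤.space V)

/-- The iterated bracket `[⋯[[Δ, a₁]_B, a₂]_B, ⋯, a_k]_B` with `Δ = ∑_k l_k ⊞ ρ_k`, for a list of
pairs `(nᵢ, aᵢ)` with `aᵢ ∈ Hom^{nᵢ}(T̄(V), 𝔤)`; the first component records its degree. -/
noncomputable def iteratedBracket (r : 𝔤.Representation V) (as : List (ℤ × (V.T →ₗ[K] 𝔤.space))) :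
    ℤ × (r.total.T →ₗ[K] r.total) :=
  as.foldl (fun f a => (f.1 + a.1, r.total.balavoine f.1 a.1 f.2 (r.horizontalLift a.2)))
    (1, r.hemisemidirect)

/-- The brackets `𝔩_k(a₁, …, a_k) = P[⋯[[Δ, a₁]_B, a₂]_B, ⋯, a_k]_B` of the derived `L_∞`-algebra
`𝔥 = ⨁ₙ Homⁿ(T̄(V), 𝔤)`. -/
noncomputable def derivedBracket (r : 𝔤.Representation V)
    (as : List (ℤ × (V.T →ₗ[K] 𝔤.space))) : V.T →ₗ[K] 𝔤.space :=
  r.proj (r.iteratedBracket as).2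

/-- Homotopy embedding tensors: Maurer-Cartan elements of the derived `L_∞`-algebra, that is,
elements `Θ ∈ Hom⁰(T̄(V), 𝔤)` with `∑_{k ≥ 1} 1/k! 𝔩_k(Θ, …, Θ) = 0`. -/
structure IsHomotopyEmbeddingTensor (r : 𝔤.Representation V) (Θ : V.T →ₗ[K] 𝔤.space) : Prop where
  isCochain : IsCochain V 𝔤.space 0 Θ
  maurerCartan : pointwiseSum
    (fun k : ℕ => ((k + 1).factorial : K)⁻¹ • r.derivedBracket (List.replicate (k + 1) (0, Θ))) = 0

/-- The `n`-th power `[·, Θ]_B^n` of the operator `[·, Θ]_B`, for `Θ` of degree `0`, applied to an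
element `f` of degree `m`. -/
noncomputable def adPow (r : 𝔤.Representation V) (Θ : V.T →ₗ[K] 𝔤.space) (m : ℤ) (n : ℕ)
    (f : r.total.T →ₗ[K] r.total) : r.total.T →ₗ[K] r.total :=
  (fun f => r.total.balavoine m 0 f (r.horizontalLift Θ))^[n] f

/-- `e^{[·, Θ]_B} f = ∑_n 1/n! [·, Θ]_B^n f`, for `f` of degree `m`. -/
noncomputable def expAd (r : 𝔤.Representation V) (Θ : V.T →ₗ[K] 𝔤.space) (m : ℤ)
    (f : r.total.T →ₗ[K] r.total) : r.total.T →ₗ[K] r.total :=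
  pointwiseSum fun n : ℕ => (n.factorial : K)⁻¹ • r.adPow Θ m n f

/-- The maps `θ_k(v₁, …, v_k) = (e^{[·, Θ]_B} ∑_k l_k ⊞ ρ_k)(v₁, …, v_k)` on `V`
(their `V`-component). -/
noncomputable def twist (r : 𝔤.Representation V) (Θ : V.T →ₗ[K] 𝔤.space) : V.T →ₗ[K] V :=
  LinearMap.snd K 𝔤.space V ∘ₗ r.expAd Θ 1 r.hemisemidirect ∘ₗ
    tmap (W := r.total) (LinearMap.inr K 𝔤.space V)

end LInfinityAlgebra.Representation

/-- Objects of the category of homotopy embedding tensors: an `L_∞`-algebra, a representation, and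
a homotopy embedding tensor. -/
structure HomotopyEmbeddingTensor (K : Type w) [Field K] where
  algebra : LInfinityAlgebra.{w, u} K
  space : GradedSpace.{w, v} K
  rep : algebra.Representation space
  Θ : space.T →ₗ[K] algebra.space
  isHomotopyEmbeddingTensor : rep.IsHomotopyEmbeddingTensor Θ

namespace HomotopyEmbeddingTensor

variable {K : Type w} [Field K]

/-- Strict homomorphisms of homotopy embedding tensors. -/
@[ext]
structure Hom (A B : HomotopyEmbeddingTensor.{w, u, v} K) where
  φ𝔤 : A.algebra.space →ₗ[K] B.algebra.space
  φV : A.space →ₗ[K] B.space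
  φ𝔤_degree : ∀ d, ∀ x ∈ A.algebra.space.piece d, φ𝔤 x ∈ B.algebra.space.piece d
  φV_degree : ∀ d, ∀ v ∈ A.space.piece d, φV v ∈ B.space.piece d
  map_l : ∀ X, φ𝔤 (A.algebra.l X) = B.algebra.l (tmap φ𝔤 X)
  map_Θ : ∀ X, φ𝔤 (A.Θ X) = B.Θ (tmap φV X)
  map_ρ : ∀ X u, φV (A.rep.ρ X u) = B.rep.ρ (tmap φ𝔤 X) (φV u)

instance : CategoryTheory.Category (HomotopyEmbeddingTensor.{w, u, v} K) where
  Hom := Hom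
  id A :=
    { φ𝔤 := LinearMap.id
      φV := LinearMap.id
      φ𝔤_degree := fun _ _ h => h
      φV_degree := fun _ _ h => h
      map_l := by simp [tmap_id]
      map_Θ := by simp [tmap_id]
      map_ρ := by simp [tmap_id] }
  comp f g :=
    { φ𝔤 := g.φ𝔤 ∘ₗ f.φ𝔤
      φV := g.φV ∘ₗ f.φV
      φ𝔤_degree := fun _ _ h => g.φ𝔤_degree _ _ (f.φ𝔤_degree _ _ h)
      φV_degree := fun _ _ h => g.φV_degree _ _ (f.φV_degree _ _ h)
      map_l := fun X => by simp [f.map_l, g.map_l, tmap_comp]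
      map_Θ := fun X => by simp [f.map_Θ, g.map_Θ, tmap_comp]
      map_ρ := fun X u => by simp [f.map_ρ, g.map_ρ, tmap_comp] }

end HomotopyEmbeddingTensor

/-- `Leibniz_∞`-algebras: graded spaces with a Maurer-Cartan element `θ = ∑_k θ_k` of the graded
Balavoine algebra. -/
structure LeibnizInfinityAlgebra (K : Type w) [Field K] where
  space : GradedSpace.{w, u} K
  θ : space.T →ₗ[K] space
  isMaurerCartan : space.IsMaurerCartan θ

namespace LeibnizInfinityAlgebra

variable {K : Type w} [Field K]

/-- Homomorphisms `f = ∑_k f_k` of `Leibniz_∞`-algebras: `f ∈ Hom⁰(T̄(A), B)` such that, for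
homogeneous `x₁, …, xₙ ∈ A`,
`∑ (-1)^{x_{σ(1)} + ⋯ + x_{σ(k-1)}} ε(σ) f(x_{σ(1)}, …, x_{σ(k-1)}, θ(x_{σ(k)}, …, x_{k+i-1}), …, xₙ)
  = ∑ ε(σ) θ'(f(x_{σ(1)}, …), …, f(…, x_{σ(n)}))`. -/
@[ext]
structure Hom (A B : LeibnizInfinityAlgebra.{w, u} K) where
  toLinearMap : A.space.T →ₗ[K] B.space
  isCochain : IsCochain A.space B.space 0 toLinearMap
  map_θ : toLinearMap ∘ₗ A.space.insertion 1 A.θ = B.θ ∘ₗ barMap toLinearMap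

end LeibnizInfinityAlgebra

namespace GradedSpace

variable {K : Type w} [Field K]

section CoshuffleLemmas

variable {V : GradedSpace.{w, u} K}

@[simp] theorem mulLetter_apply (x : V) (X : V.T) : V.mulLetter x X = X * V.letter x := by
  simp [mulLetter]

@[simp] theorem tparity_one : V.tparity 1 = 1 := by simp [tparity]

@[simp] theorem tparity_mul (X Y : V.T) : V.tparity (X * Y) = V.tparity X * V.tparity Y := by
  simp [tparity]

@[simp] theorem tparity_letter (x : V) : V.tparity (V.letter x) = V.letter (V.parity x) := by
  simp [tparity]

@[simp] theorem tparity_tparity (X : V.T) : V.tparity (V.tparity X) = X := by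
  refine LinearMap.congr_fun (f := V.tparity ∘ₗ V.tparity) (g := LinearMap.id)
    (ext_letter (by simp) ?_) X
  intro X x h
  simp only [LinearMap.comp_apply, LinearMap.id_apply] at h
  simp [h, parity_parity]

theorem parity_evenPart (x : V) : V.parity (V.evenPart x) = V.evenPart x := by
  simp [evenPart, parity_parity, add_comm]

theorem parity_oddPart (x : V) : V.parity (V.oddPart x) = - V.oddPart x := by
  simp [oddPart, parity_parity, ← smul_neg]

theorem evenPart_parity (x : V) : V.evenPart (V.parity x) = V.evenPart x := by
  simp [evenPart, parity_parity, add_comm]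

theorem oddPart_parity (x : V) : V.oddPart (V.parity x) = - V.oddPart x := by
  simp [oddPart, parity_parity, ← smul_neg]

theorem evenPart_oddPart (x : V) : V.evenPart (V.oddPart x) = 0 := by
  simp [evenPart, parity_oddPart]

theorem oddPart_evenPart (x : V) : V.oddPart (V.evenPart x) = 0 := by
  simp [oddPart, parity_evenPart]

theorem coshuffleStep_tmul (x : V) (X Y : V.T) :
    V.coshuffleStep x (X ⊗ₜ Y) = (X * V.letter (V.evenPart x)) ⊗ₜ Y +
      (X * V.letter (V.oddPart x)) ⊗ₜ V.tparity Y + X ⊗ₜ (Y * V.letter x) := by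
  simp [coshuffleStep]

@[simp] theorem coshuffle_one : V.coshuffle 1 = 1 ⊗ₜ 1 := by simp [coshuffle]

@[simp] theorem coshuffle_mul (X : V.T) (x : V) :
    V.coshuffle (X * V.letter x) = V.coshuffleStep x (V.coshuffle X) := by
  simp [coshuffle]

@[simp] theorem halfCoshuffle_one : V.halfCoshuffle 1 = 0 := by simp [halfCoshuffle]

theorem halfCoshuffle_mul (X : V.T) (x : V) :
    V.halfCoshuffle (X * V.letter x) =
      TensorProduct.map LinearMap.id (V.mulLetter x) (V.coshuffle X) := by
  simp [halfCoshuffle, LinearMap.lTensor]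

/-- The coshuffle coproduct commutes with the parity operators. -/
theorem coshuffle_tparity (X : V.T) :
    V.coshuffle (V.tparity X) = TensorProduct.map V.tparity V.tparity (V.coshuffle X) := by
  refine LinearMap.congr_fun (f := V.coshuffle ∘ₗ V.tparity)
    (g := TensorProduct.map V.tparity V.tparity ∘ₗ V.coshuffle) (ext_letter (by simp) ?_) X
  intro X x h
  simp only [LinearMap.comp_apply] at h
  simp only [LinearMap.comp_apply, tparity_mul, tparity_letter, coshuffle_mul, h]
  generalize V.coshuffle X = z
  induction z with
  | zero => simp
  | add a b ha hb => simp only [map_add, ha, hb]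
  | tmul a b =>
    simp [coshuffleStep_tmul, evenPart_parity, oddPart_parity, parity_evenPart, parity_oddPart,
      TensorProduct.neg_tmul]

theorem halfCoshuffle_tparity (X : V.T) :
    V.halfCoshuffle (V.tparity X) = TensorProduct.map V.tparity V.tparity (V.halfCoshuffle X) := by
  refine LinearMap.congr_fun (f := V.halfCoshuffle ∘ₗ V.tparity)
    (g := TensorProduct.map V.tparity V.tparity ∘ₗ V.halfCoshuffle) (ext_letter (by simp) ?_) X
  intro X x _
  simp only [LinearMap.comp_apply, tparity_mul, tparity_letter, halfCoshuffle_mul,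
    coshuffle_tparity]
  generalize V.coshuffle X = z
  induction z with
  | zero => simp
  | add a b ha hb => simp only [map_add, ha, hb]
  | tmul a b => simp

/-- The graded flip `X ⊗ Y ↦ (-1)^{|X||Y|} Y ⊗ X` of `T(V) ⊗ T(V)`. -/
noncomputable def flip (V : GradedSpace.{w, u} K) : V.T ⊗[K] V.T →ₗ[K] V.T ⊗[K] V.T :=
  (2⁻¹ : K) • ((TensorProduct.comm K V.T V.T).toLinearMap ∘ₗ
    (TensorProduct.map LinearMap.id (LinearMap.id + V.tparity) +
      TensorProduct.map V.tparity (LinearMap.id - V.tparity)))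

theorem flip_tmul (X Y : V.T) : V.flip (X ⊗ₜ Y) =
    (2⁻¹ : K) • ((Y + V.tparity Y) ⊗ₜ X + (Y - V.tparity Y) ⊗ₜ V.tparity X) := by
  simp [flip]

theorem flip_tparity (z : V.T ⊗[K] V.T) : V.flip (TensorProduct.map V.tparity V.tparity z) =
    TensorProduct.map V.tparity V.tparity (V.flip z) := by
  induction z with
  | zero => simp
  | add a b ha hb => simp only [map_add, ha, hb]
  | tmul a b => simp [flip_tmul]

variable [CharZero K]

theorem evenPart_add_oddPart (x : V) : V.evenPart x + V.oddPart x = x := by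
  simp only [evenPart, oddPart, LinearMap.smul_apply, LinearMap.add_apply, LinearMap.sub_apply,
    LinearMap.id_apply, ← smul_add]
  rw [add_add_sub_cancel, ← two_smul K x, smul_smul, inv_mul_cancel₀ two_ne_zero, one_smul]

theorem evenPart_evenPart (x : V) : V.evenPart (V.evenPart x) = V.evenPart x := by
  have := evenPart_add_oddPart (V.evenPart x)
  rwa [oddPart_evenPart, add_zero] at this

theorem oddPart_oddPart (x : V) : V.oddPart (V.oddPart x) = V.oddPart x := by
  have := evenPart_add_oddPart (V.oddPart x)
  rwa [evenPart_oddPart, zero_add] at this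

theorem evenPart_of_even {d : ℤ} (hd : Even d) {x : V} (hx : x ∈ V.piece d) :
    V.evenPart x = x ∧ V.oddPart x = 0 := by
  have h : V.oddPart x = 0 := by simp [oddPart, V.parity_apply hx, hd.neg_one_zpow]
  have := evenPart_add_oddPart x
  rw [h, add_zero] at this
  exact ⟨this, h⟩

theorem oddPart_of_odd {d : ℤ} (hd : Odd d) {x : V} (hx : x ∈ V.piece d) :
    V.evenPart x = 0 ∧ V.oddPart x = x := by
  have h : V.evenPart x = 0 := by simp [evenPart, V.parity_apply hx, hd.neg_one_zpow]
  have := evenPart_add_oddPart x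
  rw [h, zero_add] at this
  exact ⟨h, this⟩

/-- Coassociativity of the coshuffle coproduct. -/
theorem coshuffle_coassoc (X : V.T) :
    TensorProduct.map V.coshuffle LinearMap.id (V.coshuffle X) =
      (TensorProduct.assoc K V.T V.T V.T).symm
        (TensorProduct.map LinearMap.id V.coshuffle (V.coshuffle X)) := by
  refine LinearMap.congr_fun (f := TensorProduct.map V.coshuffle LinearMap.id ∘ₗ V.coshuffle)
    (g := (TensorProduct.assoc K V.T V.T V.T).symm.toLinearMap ∘ₗ
      TensorProduct.map LinearMap.id V.coshuffle ∘ₗ V.coshuffle) (ext_letter ?_ ?_) X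
  · simp only [LinearMap.comp_apply, coshuffle_one, TensorProduct.map_tmul, LinearMap.id_apply,
      LinearEquiv.coe_coe, TensorProduct.assoc_symm_tmul]
  intro X x h
  let R : (V.T ⊗[K] V.T) ⊗[K] V.T →ₗ[K] (V.T ⊗[K] V.T) ⊗[K] V.T :=
    TensorProduct.map (V.coshuffleStep (V.evenPart x)) LinearMap.id +
    TensorProduct.map (V.coshuffleStep (V.oddPart x)) V.tparity +
    TensorProduct.map LinearMap.id (V.mulLetter x)
  have h1 : ∀ z, TensorProduct.map V.coshuffle LinearMap.id (V.coshuffleStep x z) =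
      R (TensorProduct.map V.coshuffle LinearMap.id z) := by
    intro z
    induction z with
    | zero => simp
    | add a b ha hb => simp only [map_add, ha, hb]
    | tmul a b => simp [coshuffleStep_tmul, R]
  have h2 : ∀ z, (TensorProduct.assoc K V.T V.T V.T).symm
      (TensorProduct.map LinearMap.id V.coshuffle (V.coshuffleStep x z)) =
      R ((TensorProduct.assoc K V.T V.T V.T).symm (TensorProduct.map LinearMap.id V.coshuffle z)) := by
    intro z
    induction z with
    | zero => simp
    | add a b ha hb => simp only [map_add, ha, hb]
    | tmul a b =>
      simp only [coshuffleStep_tmul, map_add, TensorProduct.map_tmul, LinearMap.id_apply,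
        coshuffle_tparity, coshuffle_mul]
      generalize V.coshuffle b = z
      induction z with
      | zero => simp
      | add a b ha hb =>
        simp only [map_add, TensorProduct.tmul_add] at ha hb ⊢
        rw [← ha, ← hb]; abel
      | tmul c d =>
        simp only [R, coshuffleStep_tmul, map_add, TensorProduct.map_tmul, LinearMap.id_apply,
          TensorProduct.assoc_symm_tmul, LinearMap.add_apply, TensorProduct.tmul_add,
          TensorProduct.add_tmul, mulLetter_apply, evenPart_evenPart, oddPart_oddPart,
          evenPart_oddPart, oddPart_evenPart, map_zero, mul_zero, TensorProduct.zero_tmul,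
          add_zero, zero_add]
        abel
  simp only [LinearMap.comp_apply, LinearEquiv.coe_coe, coshuffle_mul] at h ⊢
  rw [h1, h2, h]

theorem coshuffleStep_eq (x : V) (z : V.T ⊗[K] V.T) : V.coshuffleStep x z =
    V.flip (TensorProduct.map LinearMap.id (V.mulLetter x) (V.flip z)) +
      TensorProduct.map LinearMap.id (V.mulLetter x) z := by
  have h2 : (2⁻¹ : K) = 4⁻¹ + 4⁻¹ := by norm_num
  induction z with
  | zero => simp
  | add a b ha hb => simp only [map_add, ha, hb]; abel
  | tmul a b =>
    simp only [coshuffleStep_tmul, flip_tmul, map_add, map_sub, map_smul, TensorProduct.map_tmul,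
      LinearMap.id_apply, mulLetter_apply, tparity_mul, tparity_letter,
      tparity_tparity, TensorProduct.add_tmul, TensorProduct.sub_tmul, smul_add, smul_sub, evenPart, oddPart, LinearMap.smul_apply,
      LinearMap.add_apply, LinearMap.sub_apply, mul_smul_comm, mul_add, mul_sub,
      ← TensorProduct.smul_tmul']
    module

theorem flip_flip (z : V.T ⊗[K] V.T) : V.flip (V.flip z) = z := by
  induction z with
  | zero => simp
  | add a b ha hb => simp only [map_add, ha, hb]
  | tmul a b =>
    simp only [flip_tmul, map_add, map_sub, map_smul, tparity_tparity, TensorProduct.add_tmul,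
      TensorProduct.sub_tmul, smul_add, smul_sub]
    module

/-- Graded cocommutativity of the coshuffle coproduct. -/
theorem flip_coshuffle (X : V.T) : V.flip (V.coshuffle X) = V.coshuffle X := by
  refine LinearMap.congr_fun (f := V.flip ∘ₗ V.coshuffle) (g := V.coshuffle) (ext_letter ?_ ?_) X
  · simp only [LinearMap.comp_apply, coshuffle_one, flip_tmul, tparity_one, sub_self,
      TensorProduct.zero_tmul, add_zero]
    rw [← two_smul K (1 : V.T), ← TensorProduct.smul_tmul', smul_smul,
      inv_mul_cancel₀ two_ne_zero, one_smul]
  · intro X x h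
    simp only [LinearMap.comp_apply] at h
    simp only [LinearMap.comp_apply, coshuffle_mul]
    rw [coshuffleStep_eq, map_add, flip_flip, h, add_comm]

theorem coshuffle_eq (X : V.T) : V.coshuffle X =
    V.halfCoshuffle X + V.flip (V.halfCoshuffle X) + V.counit X • (1 ⊗ₜ 1) := by
  refine LinearMap.congr_fun (f := V.coshuffle)
    (g := V.halfCoshuffle + V.flip ∘ₗ V.halfCoshuffle +
      (V.counit.toLinearMap.smulRight (1 ⊗ₜ 1))) (ext_letter (by simp) ?_) X
  intro X x _
  simp [halfCoshuffle_mul, coshuffleStep_eq, flip_coshuffle, TensorAlgebra.algebraMapInv]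
  abel

end CoshuffleLemmas

section BarLemmas

variable {V : GradedSpace.{w, u} K} {W : GradedSpace.{w, v} K}

/-- Words of length at most `n`. -/
noncomputable def fil (V : GradedSpace.{w, u} K) (n : ℕ) : Submodule K V.T :=
  (1 ⊔ LinearMap.range V.letter) ^ n

theorem one_mem_fil (n : ℕ) : (1 : V.T) ∈ V.fil n := by
  induction n with
  | zero => simp [fil, Submodule.one_le.mp le_rfl]
  | succ n ih =>
    rw [fil, pow_succ]
    simpa [fil] using Submodule.mul_mem_mul ih
      (Submodule.mem_sup_left (Submodule.one_le.mp le_rfl) :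
        (1 : V.T) ∈ 1 ⊔ LinearMap.range V.letter)

theorem mul_letter_mem_fil {n : ℕ} {X : V.T} (hX : X ∈ V.fil n) (x : V) :
    X * V.letter x ∈ V.fil (n + 1) := by
  rw [fil, pow_succ]
  exact Submodule.mul_mem_mul hX (Submodule.mem_sup_right ⟨x, rfl⟩)

theorem fil_succ_le {n : ℕ} {P : Submodule K V.T} (h1 : V.fil n ≤ P)
    (h : ∀ X ∈ V.fil n, ∀ x, X * V.letter x ∈ P) : V.fil (n + 1) ≤ P := by
  rw [fil, pow_succ, Submodule.mul_le]
  intro X hX y hy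
  obtain ⟨a, ha, b, ⟨x, rfl⟩, rfl⟩ := Submodule.mem_sup.mp hy
  rw [mul_add]
  refine P.add_mem ?_ (h X hX x)
  obtain ⟨c, rfl⟩ := Submodule.mem_one.mp ha
  rw [← Algebra.commutes, ← Algebra.smul_def]
  exact P.smul_mem c (h1 hX)

theorem fil_zero_le {P : Submodule K V.T} (h1 : 1 ∈ P) : V.fil 0 ≤ P := by
  rw [fil, pow_zero]
  exact Submodule.one_le.mpr h1

theorem fil_mono : Monotone V.fil := by
  refine monotone_nat_of_le_succ fun n X hX => ?_
  rw [fil, pow_succ]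
  simpa [fil] using Submodule.mul_mem_mul hX
    (Submodule.mem_sup_left (Submodule.one_le.mp le_rfl) :
      (1 : V.T) ∈ 1 ⊔ LinearMap.range V.letter)

theorem exists_mem_fil (X : V.T) : ∃ n, X ∈ V.fil n := by
  have h : (⨆ n, V.fil n) = ⊤ := by
    refine eq_top_of_mul_letter _ (Submodule.mem_iSup_of_mem 0 (one_mem_fil 0)) ?_
    intro X hX x
    obtain ⟨n, hn⟩ := (Submodule.mem_iSup_of_directed _ fil_mono.directed_le).mp hX
    exact Submodule.mem_iSup_of_mem (n + 1) (mul_letter_mem_fil hn x)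
  exact (Submodule.mem_iSup_of_directed _ fil_mono.directed_le).mp (h ▸ Submodule.mem_top)

/-- Tensors whose left factors have length at most `n`. -/
noncomputable def filT (V : GradedSpace.{w, u} K) (n : ℕ) : Submodule K (V.T ⊗[K] V.T) :=
  LinearMap.range (TensorProduct.map (V.fil n).subtype (LinearMap.id : V.T →ₗ[K] V.T))

theorem tmul_mem_filT {n : ℕ} {X : V.T} (hX : X ∈ V.fil n) (Y : V.T) : X ⊗ₜ Y ∈ V.filT n :=
  ⟨⟨X, hX⟩ ⊗ₜ Y, by simp⟩

theorem filT_map {n m : ℕ} {g h : V.T →ₗ[K] V.T} (hg : ∀ X ∈ V.fil n, g X ∈ V.fil m)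
    {z : V.T ⊗[K] V.T} (hz : z ∈ V.filT n) : TensorProduct.map g h z ∈ V.filT m := by
  obtain ⟨y, rfl⟩ := hz
  induction y with
  | zero => simp
  | add a b ha hb => simp only [map_add]; exact add_mem ha hb
  | tmul a b => exact tmul_mem_filT (hg _ a.2) _

theorem filT_congr {M N : Type*} [AddCommMonoid M] [Module K M] [AddCommMonoid N] [Module K N]
    {n : ℕ} {A B : V.T →ₗ[K] M} (k : V.T →ₗ[K] N) (h : ∀ X ∈ V.fil n, A X = B X)
    {z : V.T ⊗[K] V.T} (hz : z ∈ V.filT n) : TensorProduct.map A k z = TensorProduct.map B k z := by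
  obtain ⟨y, rfl⟩ := hz
  induction y with
  | zero => simp
  | add a b ha hb => simp only [map_add, ha, hb]
  | tmul a b => simp [h _ a.2]

theorem coshuffle_mem_filT {n : ℕ} : ∀ {X : V.T}, X ∈ V.fil n → V.coshuffle X ∈ V.filT n := by
  induction n with
  | zero =>
    intro X hX
    refine fil_zero_le (P := (V.filT 0).comap V.coshuffle) ?_ hX
    simpa using tmul_mem_filT (one_mem_fil 0) 1
  | succ n ih =>
    intro X hX
    have hm : V.filT n ≤ V.filT (n + 1) := fun z hz => by
      simpa using filT_map (g := LinearMap.id) (h := LinearMap.id)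
        (fun X hX => fil_mono n.le_succ hX) hz
    refine fil_succ_le (P := (V.filT (n + 1)).comap V.coshuffle) (fun Y hY => hm (ih hY)) ?_ hX
    intro Y hY x
    rw [Submodule.mem_comap, coshuffle_mul]
    refine add_mem (add_mem ?_ ?_) ?_
    · exact filT_map (fun Z hZ => by simpa using mul_letter_mem_fil hZ _) (ih hY)
    · exact filT_map (fun Z hZ => by simpa using mul_letter_mem_fil hZ _) (ih hY)
    · exact hm (filT_map (fun Z hZ => hZ) (ih hY))

theorem map_comp_apply {A B C D E F : Type*} [AddCommMonoid A] [Module K A] [AddCommMonoid B]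
    [Module K B] [AddCommMonoid C] [Module K C] [AddCommMonoid D] [Module K D] [AddCommMonoid E]
    [Module K E] [AddCommMonoid F] [Module K F] (g : B →ₗ[K] C) (f : A →ₗ[K] B) (k : E →ₗ[K] F)
    (h : D →ₗ[K] E) (z : A ⊗[K] D) : TensorProduct.map g k (TensorProduct.map f h z) =
      TensorProduct.map (g ∘ₗ f) (k ∘ₗ h) z := by
  rw [TensorProduct.map_comp, LinearMap.comp_apply]

theorem map_halfCoshuffle_mul {M N : Type*} [AddCommMonoid M] [Module K M] [AddCommMonoid N]
    [Module K N] (A : V.T →ₗ[K] M) (k : V.T →ₗ[K] N) (X : V.T) (x : V) :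
    TensorProduct.map A k (V.halfCoshuffle (X * V.letter x)) =
      TensorProduct.map A (k ∘ₗ V.mulLetter x) (V.coshuffle X) := by
  rw [halfCoshuffle_mul, map_comp_apply, LinearMap.comp_id]

theorem eq_zero_of_rec {G k : V.T →ₗ[K] W.T} (h1 : G 1 = 0)
    (h : ∀ X x, G (X * V.letter x) =
      LinearMap.mul' K W.T (TensorProduct.map G k (V.halfCoshuffle (X * V.letter x)))) (X : V.T) :
    G X = 0 := by
  have key : ∀ n, V.fil n ≤ LinearMap.ker G := by
    intro n
    induction n with
    | zero => exact fil_zero_le h1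
    | succ n ih =>
      refine fil_succ_le ih fun X hX x => ?_
      rw [LinearMap.mem_ker, h, map_halfCoshuffle_mul,
        filT_congr (B := 0) _ (fun Y hY => ih hY) (coshuffle_mem_filT hX)]
      simp
  obtain ⟨n, hn⟩ := exists_mem_fil X
  exact key n hn

theorem eq_of_rec {F G k : V.T →ₗ[K] W.T} (h1 : F 1 = G 1)
    (hF : ∀ X x, F (X * V.letter x) =
      LinearMap.mul' K W.T (TensorProduct.map F k (V.halfCoshuffle (X * V.letter x))))
    (hG : ∀ X x, G (X * V.letter x) =
      LinearMap.mul' K W.T (TensorProduct.map G k (V.halfCoshuffle (X * V.letter x)))) : F = G := by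
  rw [← sub_eq_zero]
  ext X
  refine eq_zero_of_rec (k := k) (by simp [h1]) (fun X x => ?_) X
  rw [LinearMap.sub_apply, hF, hG, ← map_sub]
  congr 1
  generalize V.halfCoshuffle _ = z
  induction z with
  | zero => simp
  | add a b ha hb => simp only [map_add, ← ha, ← hb]; abel
  | tmul a b => simp [TensorProduct.sub_tmul]

@[simp] theorem counit_one : V.counit 1 = 1 := map_one _

@[simp] theorem counit_mul_letter (X : V.T) (x : V) : V.counit (X * V.letter x) = 0 := by
  simp [TensorAlgebra.algebraMapInv]

theorem barPart_eq_zero (f : V.T →ₗ[K] W) {n : ℕ} : ∀ {p : ℕ}, n < p → ∀ {X : V.T}, X ∈ V.fil n →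
    barPart f p X = 0 := by
  induction n with
  | zero =>
    intro p hp X hX
    obtain ⟨p, rfl⟩ := Nat.exists_eq_add_of_lt hp
    exact fil_zero_le (P := LinearMap.ker (barPart f _)) (by simp [barPart]) hX
  | succ n ih =>
    intro p hp X hX
    obtain ⟨p, rfl⟩ : ∃ q, p = q + 1 := ⟨p - 1, by omega⟩
    refine fil_succ_le (P := LinearMap.ker (barPart f (p + 1)))
      (fun Y hY => ih (by omega) hY) (fun Y hY x => ?_) hX
    rw [LinearMap.mem_ker, barPart, LinearMap.comp_apply, LinearMap.comp_apply,
      map_halfCoshuffle_mul, filT_congr (B := 0) _ (fun Z hZ => ih (by omega) hZ)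
      (coshuffle_mem_filT hY)]
    simp

theorem barPart_pointwiseFinite (f : V.T →ₗ[K] W) : PointwiseFinite (barPart f) := by
  intro X
  obtain ⟨n, hn⟩ := exists_mem_fil X
  refine (Finset.range (n + 1)).finite_toSet.subset fun p hp => ?_
  by_contra h
  exact hp (barPart_eq_zero f (by simpa using h) hn)

theorem barMap_apply (f : V.T →ₗ[K] W) {n : ℕ} {X : V.T} (hX : X ∈ V.fil n) :
    barMap f X = ∑ p ∈ Finset.range (n + 1), barPart f p X := by
  rw [barMap, pointwiseSum, dif_pos (barPart_pointwiseFinite f)]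
  refine finsum_eq_sum_of_support_subset _ fun p hp => ?_
  by_contra h
  exact hp (barPart_eq_zero f (by simpa using h) hX)

@[simp] theorem barMap_one (f : V.T →ₗ[K] W) : barMap f 1 = 1 := by
  rw [barMap_apply f (one_mem_fil 0)]
  simp [barPart]

theorem barMap_mul (f : V.T →ₗ[K] W) (X : V.T) (x : V) : barMap f (X * V.letter x) =
    LinearMap.mul' K W.T (TensorProduct.map (barMap f) (W.letter ∘ₗ f)
      (V.halfCoshuffle (X * V.letter x))) := by
  obtain ⟨n, hn⟩ := exists_mem_fil X
  have h : ∀ (s : Finset ℕ) (k : V.T →ₗ[K] W.T) z,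
      TensorProduct.map (∑ p ∈ s, barPart f p) k z =
        ∑ p ∈ s, TensorProduct.map (barPart f p) k z := by
    intro s k z
    induction s using Finset.induction_on with
    | empty => simp
    | insert a s ha ih => simp [Finset.sum_insert ha, TensorProduct.map_add_left, ih]
  rw [barMap_apply f (mul_letter_mem_fil hn x), Finset.sum_range_succ', map_halfCoshuffle_mul,
    filT_congr (B := ∑ p ∈ Finset.range (n + 1), barPart f p) _
      (fun Z hZ => by rw [barMap_apply f hZ, LinearMap.sum_apply]) (coshuffle_mem_filT hn), h,
    map_sum]
  simp [barPart, map_halfCoshuffle_mul]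

theorem counit_mul'_letter {M : Type*} [AddCommMonoid M] [Module K M] (A : M →ₗ[K] W.T)
    (k : M →ₗ[K] W) (z : M ⊗[K] M) :
    W.counit (LinearMap.mul' K W.T (TensorProduct.map A (W.letter ∘ₗ k) z)) = 0 := by
  induction z with
  | zero => simp
  | add a b ha hb => simp only [map_add, ha, hb, add_zero]
  | tmul a b => simp only [TensorProduct.map_tmul, LinearMap.mul'_apply, LinearMap.comp_apply,
      counit_mul_letter]

theorem counit_barMap (f : V.T →ₗ[K] W) (X : V.T) : W.counit (barMap f X) = V.counit X := by
  refine LinearMap.congr_fun (f := W.counit.toLinearMap ∘ₗ barMap f) (g := V.counit.toLinearMap)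
    (ext_letter (by simp) ?_) X
  intro X x _
  simp only [LinearMap.comp_apply, AlgHom.toLinearMap_apply, barMap_mul, counit_mul'_letter,
    counit_mul_letter]

@[simp] theorem ιInv_one : TensorAlgebra.ιInv (1 : V.T) = 0 := by
  let _ : Module Kᵐᵒᵖ V := Module.compHom _ ((RingHom.id K).fromOpposite mul_comm)
  have _ : IsCentralScalar K V := ⟨fun r m => rfl⟩
  change (TensorAlgebra.toTrivSqZeroExt (1 : V.T)).snd = 0
  rw [map_one, TrivSqZeroExt.snd_one]

@[simp] theorem ιInv_letter (x : V) : TensorAlgebra.ιInv (V.letter x) = x :=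
  TensorAlgebra.ι_leftInverse x

theorem ιInv_mul_letter (X : V.T) (x : V) :
    TensorAlgebra.ιInv (X * V.letter x) = V.counit X • x := by
  let _ : Module Kᵐᵒᵖ V := Module.compHom _ ((RingHom.id K).fromOpposite mul_comm)
  have _ : IsCentralScalar K V := ⟨fun r m => rfl⟩
  have h : ∀ Y : V.T, (TensorAlgebra.toTrivSqZeroExt Y).fst = V.counit Y := by
    intro Y
    refine AlgHom.congr_fun (φ₁ := (TrivSqZeroExt.fstHom K K V).comp TensorAlgebra.toTrivSqZeroExt)
      (φ₂ := V.counit) ?_ Y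
    ext y
    simp [TensorAlgebra.algebraMapInv]
  simp [TensorAlgebra.ιInv, h]

theorem mul'_counit_left (X : V.T) : LinearMap.mul' K V.T (TensorProduct.map
    (Algebra.linearMap K V.T ∘ₗ V.counit.toLinearMap) LinearMap.id (V.coshuffle X)) = X := by
  refine LinearMap.congr_fun (f := LinearMap.mul' K V.T ∘ₗ TensorProduct.map
    (Algebra.linearMap K V.T ∘ₗ V.counit.toLinearMap) LinearMap.id ∘ₗ V.coshuffle)
    (g := LinearMap.id) (ext_letter (by simp) ?_) X
  intro X x h
  simp only [LinearMap.comp_apply, LinearMap.id_apply, coshuffle_mul] at h ⊢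
  conv_rhs => rw [← h]
  generalize V.coshuffle X = z
  induction z with
  | zero => simp
  | add a b ha hb => simp only [map_add, ha, hb, add_mul]
  | tmul a b =>
    simp only [coshuffleStep_tmul, map_add, TensorProduct.map_tmul, LinearMap.mul'_apply,
      LinearMap.comp_apply, AlgHom.toLinearMap_apply, counit_mul_letter, map_zero, zero_mul,
      zero_add, LinearMap.id_apply, mul_assoc]

theorem counit_tparity (X : V.T) : V.counit (V.tparity X) = V.counit X := by
  refine LinearMap.congr_fun (f := V.counit.toLinearMap ∘ₗ V.tparity) (g := V.counit.toLinearMap)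
    (ext_letter (by simp) ?_) X
  intro X x _
  simp only [LinearMap.comp_apply, tparity_mul, tparity_letter, AlgHom.toLinearMap_apply,
    counit_mul_letter]

end BarLemmas

section WordsLemmas

variable {V : GradedSpace.{w, u} K}

theorem one_mem_words : (1 : V.T) ∈ V.words 0 :=
  Submodule.subset_span ⟨[], by simp, by simp, by simp⟩

theorem mul_letter_mem_words {n d : ℤ} {X : V.T} (hX : X ∈ V.words n) {x : V}
    (hx : x ∈ V.piece d) : X * V.letter x ∈ V.words (n + d) := by
  induction hX using Submodule.span_induction with
  | zero => simp
  | add a b _ _ ha hb => rw [add_mul]; exact add_mem ha hb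
  | smul c a _ ha => rw [smul_mul_assoc]; exact Submodule.smul_mem _ c ha
  | mem a ha =>
    obtain ⟨L, hL, rfl, rfl⟩ := ha
    refine Submodule.subset_span ⟨L ++ [(d, x)], ?_, by simp, by simp⟩
    intro b hb
    rcases List.mem_append.mp hb with h | h
    · exact hL b h
    · rw [List.mem_singleton.mp h]; exact hx

theorem words_le {n : ℤ} (P : ℤ → Submodule K V.T) (h1 : 1 ∈ P 0)
    (h : ∀ n d : ℤ, ∀ X ∈ V.words n, X ∈ P n → ∀ x ∈ V.piece d, X * V.letter x ∈ P (n + d)) :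
    V.words n ≤ P n := by
  refine Submodule.span_le.mpr ?_
  rintro _ ⟨L, hL, rfl, rfl⟩
  induction L using List.reverseRecOn with
  | nil => simpa using h1
  | append_singleton L a ih =>
    have hL' : ∀ b ∈ L, b.2 ∈ V.piece b.1 := fun b hb => hL b (by simp [hb])
    simpa using h _ a.1 _ (Submodule.subset_span ⟨L, hL', rfl, rfl⟩) (ih hL') a.2
      (hL a (by simp))

theorem words_induction {p : V.T → Prop} (h0 : p 0) (hadd : ∀ x y, p x → p y → p (x + y))
    (h : ∀ n, ∀ x ∈ V.words n, p x) (X : V.T) : p X := by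
  have htop : (⨆ n, V.words n) = ⊤ := by
    refine eq_top_of_mul_letter _ (Submodule.mem_iSup_of_mem 0 one_mem_words) ?_
    intro X hX x
    refine Submodule.iSup_induction V.words
      (motive := fun X => X * V.letter x ∈ ⨆ n, V.words n) hX ?_ (by simp)
      (fun a b ha hb => by rw [add_mul]; exact add_mem ha hb)
    intro n X hX
    induction x using V.piece_induction with
    | h0 => simp
    | hadd x y hx hy => rw [map_add, mul_add]; exact add_mem hx hy
    | h d x hx => exact Submodule.mem_iSup_of_mem _ (mul_letter_mem_words hX hx)
  exact Submodule.iSup_induction V.words (motive := p) (htop ▸ Submodule.mem_top) h h0 hadd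

theorem tparity_words {n : ℤ} {X : V.T} (hX : X ∈ V.words n) :
    V.tparity X = (-1 : K) ^ n • X := by
  refine LinearMap.mem_eqLocus.mp (words_le (fun n => LinearMap.eqLocus V.tparity
    ((-1 : K) ^ n • LinearMap.id)) (by simp) ?_ hX)
  intro n d X _ hX x hx
  rw [LinearMap.mem_eqLocus] at hX ⊢
  rw [tparity_mul, hX, tparity_letter, V.parity_apply hx, zpow_add₀ (by norm_num)]
  simp [smul_smul, mul_comm]

theorem counit_words {n : ℤ} (hn : n ≠ 0) {X : V.T} (hX : X ∈ V.words n) : V.counit X = 0 := by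
  have := words_le (V := V) (n := n)
    (fun n => LinearMap.ker ((if n = 0 then (0 : K) else 1) • V.counit.toLinearMap))
    (by simp) (fun n d X _ _ x _ => by
      rw [LinearMap.mem_ker, LinearMap.smul_apply, AlgHom.toLinearMap_apply, counit_mul_letter,
        smul_zero]) hX
  simpa [hn] using this

variable [CharZero K]

theorem mul'_counit_right (X : V.T) : LinearMap.mul' K V.T (TensorProduct.map
    LinearMap.id (Algebra.linearMap K V.T ∘ₗ V.counit.toLinearMap) (V.coshuffle X)) = X := by
  refine LinearMap.congr_fun (f := LinearMap.mul' K V.T ∘ₗ TensorProduct.map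
    LinearMap.id (Algebra.linearMap K V.T ∘ₗ V.counit.toLinearMap) ∘ₗ V.coshuffle)
    (g := LinearMap.id) (ext_letter (by simp) ?_) X
  intro X x h
  simp only [LinearMap.comp_apply, LinearMap.id_apply, coshuffle_mul] at h ⊢
  conv_rhs => rw [← h]
  generalize V.coshuffle X = z
  induction z with
  | zero => simp
  | add a b ha hb => simp only [map_add, ha, hb, add_mul]
  | tmul a b =>
    have h2 := congrArg V.letter (evenPart_add_oddPart x)
    rw [map_add] at h2
    simp only [coshuffleStep_tmul, map_add, TensorProduct.map_tmul, LinearMap.mul'_apply,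
      LinearMap.comp_apply, AlgHom.toLinearMap_apply, counit_mul_letter, map_zero, mul_zero,
      add_zero, LinearMap.id_apply, counit_tparity, Algebra.linearMap_apply]
    rw [← add_mul, ← mul_add, h2, ← Algebra.commutes, ← Algebra.commutes, mul_assoc]

/-- The graded coshuffle coproduct on a product with a homogeneous letter. -/
theorem coshuffleStep_tmul_of_mem {d n : ℤ} {x : V} (hx : x ∈ V.piece d) (X : V.T) {Y : V.T}
    (hY : Y ∈ V.words n) : V.coshuffleStep x (X ⊗ₜ Y) =
      (-1 : K) ^ (d * n) • ((X * V.letter x) ⊗ₜ Y) + X ⊗ₜ (Y * V.letter x) := by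
  rw [coshuffleStep_tmul, tparity_words hY]
  rcases Int.even_or_odd d with hd | hd
  · rw [(evenPart_of_even hd hx).1, (evenPart_of_even hd hx).2, zpow_mul, hd.neg_one_zpow]
    simp
  · rw [(oddPart_of_odd hd hx).1, (oddPart_of_odd hd hx).2, zpow_mul, hd.neg_one_zpow]
    simp

end WordsLemmas

section BarCategory

variable {V W Z : GradedSpace.{w, u} K}

theorem insertion_aux (n : ℤ) (g : V.T →ₗ[K] V) (X : V.T) :
    (V.foldWord (S := V.T × V.T)
    (LinearMap.mk₂ K (fun v s => (s.1 * V.letter v,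
        s.2 * V.letter v + V.insertLast n g (s.1 * V.letter v)))
      (by intros; simp [mul_add]; abel) (by intros; simp)
      (by intros; simp [add_mul]; abel) (by intros; simp)) (1, 0) X).1 = X := by
  refine LinearMap.congr_fun (f := LinearMap.fst K V.T V.T ∘ₗ V.foldWord _ _)
    (g := LinearMap.id) (ext_letter ?_ ?_) X
  · simp
  · intro X x h
    simp only [LinearMap.comp_apply, LinearMap.fst_apply, LinearMap.id_apply] at h ⊢
    rw [foldWord_mul]
    simp [h]

@[simp] theorem insertion_one (n : ℤ) (g : V.T →ₗ[K] V) : V.insertion n g 1 = 0 := by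
  simp [insertion]

theorem insertion_mul (n : ℤ) (g : V.T →ₗ[K] V) (X : V.T) (x : V) :
    V.insertion n g (X * V.letter x) =
      V.insertion n g X * V.letter x + V.insertLast n g (X * V.letter x) := by
  conv_lhs => rw [insertion, LinearMap.comp_apply, foldWord_mul]
  simp only [LinearMap.mk₂_apply, LinearMap.snd_apply]
  rw [insertion_aux]
  rfl

theorem insertLast_mul (n : ℤ) (g : V.T →ₗ[K] V) (X : V.T) (x : V) :
    V.insertLast n g (X * V.letter x) = LinearMap.mul' K V.T (TensorProduct.map (V.tsign n)
      (V.letter ∘ₗ g ∘ₗ V.mulLetter x) (V.coshuffle X)) := by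
  rw [insertLast, LinearMap.comp_apply, LinearMap.comp_apply, map_halfCoshuffle_mul]
  rfl

theorem tsign_one : V.tsign 1 = V.tparity := by simp [tsign]

theorem counit_tsign (n : ℤ) (X : V.T) : V.counit (V.tsign n X) = V.counit X := by
  unfold tsign
  split_ifs
  · rfl
  · exact counit_tparity X

theorem counit_insertion (n : ℤ) (g : V.T →ₗ[K] V) (X : V.T) :
    V.counit (V.insertion n g X) = 0 := by
  refine LinearMap.congr_fun (f := V.counit.toLinearMap ∘ₗ V.insertion n g) (g := 0)
    (ext_letter (by simp) ?_) X
  intro X x _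
  simp only [LinearMap.comp_apply, AlgHom.toLinearMap_apply, insertion_mul, map_add,
    counit_mul_letter, LinearMap.zero_apply, zero_add, insertLast, counit_mul'_letter]

theorem ιInv_mul'_letter {A : V.T →ₗ[K] W.T} (hA : ∀ X, W.counit (A X) = V.counit X)
    (f : V.T →ₗ[K] W) (X : V.T) (x : V) :
    TensorAlgebra.ιInv (LinearMap.mul' K W.T (TensorProduct.map A (W.letter ∘ₗ f)
      (V.halfCoshuffle (X * V.letter x)))) = f (X * V.letter x) := by
  rw [map_halfCoshuffle_mul]
  conv_rhs => rw [← mul'_counit_left X]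
  generalize V.coshuffle X = z
  induction z with
  | zero => simp
  | add a b ha hb => simp only [map_add, ha, hb, add_mul]
  | tmul a b =>
    simp only [TensorProduct.map_tmul, LinearMap.mul'_apply, LinearMap.comp_apply,
      ιInv_mul_letter, hA, mulLetter_apply, LinearMap.id_apply, AlgHom.toLinearMap_apply,
      Algebra.linearMap_apply, ← Algebra.smul_def, smul_mul_assoc, map_smul]

theorem ιInv_barMap {f : V.T →ₗ[K] W} (h1 : f 1 = 0) (X : V.T) :
    TensorAlgebra.ιInv (barMap f X) = f X := by
  refine LinearMap.congr_fun (f := TensorAlgebra.ιInv ∘ₗ barMap f) (g := f)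
    (ext_letter (by simp [h1]) ?_) X
  intro X x _
  rw [LinearMap.comp_apply, barMap_mul, ιInv_mul'_letter (counit_barMap f)]

theorem ιInv_insertion {n : ℤ} {g : V.T →ₗ[K] V} (h1 : g 1 = 0) (X : V.T) :
    TensorAlgebra.ιInv (V.insertion n g X) = g X := by
  refine LinearMap.congr_fun (f := TensorAlgebra.ιInv ∘ₗ V.insertion n g) (g := g)
    (ext_letter (by simp [h1]) ?_) X
  intro X x _
  rw [LinearMap.comp_apply, insertion_mul, map_add, ιInv_mul_letter, counit_insertion, insertLast,
    LinearMap.comp_apply, LinearMap.comp_apply, ιInv_mul'_letter (counit_tsign n)]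
  simp

/-- The parity operators and a map of degree `m`. -/
theorem IsCochain.parity_comm {m : ℤ} {f : V.T →ₗ[K] W} (hf : IsCochain V W m f) (X : V.T) :
    f (V.tparity X) = (-1 : K) ^ m • W.parity (f X) := by
  induction X using words_induction with
  | h0 => simp
  | hadd x y hx hy => simp [hx, hy]
  | h n x hx =>
    rw [tparity_words hx, map_smul, W.parity_apply (hf.map_words n x hx), smul_smul,
      zpow_add₀ (by norm_num), mul_left_comm, ← mul_zpow]
    simp

theorem halfCoshuffle_mul'_letter {M : Type*} [AddCommMonoid M] [Module K M] (A : M →ₗ[K] W.T)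
    (k : M →ₗ[K] W) (z : M ⊗[K] M) :
    W.halfCoshuffle (LinearMap.mul' K W.T (TensorProduct.map A (W.letter ∘ₗ k) z)) =
      TensorProduct.map LinearMap.id (LinearMap.mul' K W.T) (TensorProduct.assoc K W.T W.T W.T
        (TensorProduct.map (W.coshuffle ∘ₗ A) (W.letter ∘ₗ k) z)) := by
  induction z with
  | zero => simp
  | add a b ha hb => simp only [map_add, ha, hb]
  | tmul a b =>
    simp only [TensorProduct.map_tmul, LinearMap.mul'_apply, LinearMap.comp_apply,
      halfCoshuffle_mul]
    generalize W.coshuffle (A a) = z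
    induction z with
    | zero => simp
    | add c d hc hd => simp only [map_add, hc, hd, TensorProduct.add_tmul]
    | tmul c d => simp

theorem map_mul'_assoc (F G : V.T →ₗ[K] W.T) (k : V.T →ₗ[K] W.T) (z : V.T ⊗[K] V.T) :
    TensorProduct.map LinearMap.id (LinearMap.mul' K W.T) (TensorProduct.assoc K W.T W.T W.T
      (TensorProduct.map (TensorProduct.map F G) k ((TensorProduct.assoc K V.T V.T V.T).symm
        (TensorProduct.map LinearMap.id V.coshuffle z)))) =
      TensorProduct.map F (LinearMap.mul' K W.T ∘ₗ TensorProduct.map G k ∘ₗ V.coshuffle) z := by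
  induction z with
  | zero => simp
  | add a b ha hb => simp only [map_add, ha, hb]
  | tmul a b =>
    simp only [TensorProduct.map_tmul, LinearMap.comp_apply, LinearMap.id_apply]
    generalize V.coshuffle b = z
    induction z with
    | zero => simp
    | add c d hc hd => simp only [map_add, hc, hd, TensorProduct.tmul_add]
    | tmul c d => simp

theorem flip_map {F : V.T →ₗ[K] W.T} (hF : ∀ X, F (V.tparity X) = W.tparity (F X))
    (z : V.T ⊗[K] V.T) :
    W.flip (TensorProduct.map F F z) = TensorProduct.map F F (V.flip z) := by
  induction z with
  | zero => simp
  | add a b ha hb => simp only [map_add, ha, hb]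
  | tmul a b => simp [flip_tmul, hF]

theorem barMap_tparity {f : V.T →ₗ[K] W} (hf : IsCochain V W 0 f) (X : V.T) :
    barMap f (V.tparity X) = W.tparity (barMap f X) := by
  have hf' : ∀ X, f (V.tparity X) = W.parity (f X) := fun X => by simpa using hf.parity_comm X
  rw [← sub_eq_zero]
  refine eq_zero_of_rec (G := barMap f ∘ₗ V.tparity - W.tparity ∘ₗ barMap f)
    (k := W.letter ∘ₗ W.parity ∘ₗ f) (by simp) ?_ X
  intro X x
  simp only [LinearMap.sub_apply, LinearMap.comp_apply]
  rw [tparity_mul, tparity_letter, barMap_mul, barMap_mul, ← tparity_letter, ← tparity_mul,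
    halfCoshuffle_tparity]
  generalize V.halfCoshuffle _ = z
  induction z with
  | zero => simp
  | add a b ha hb => simp only [map_add, ← ha, ← hb]; abel
  | tmul a b => simp [hf', sub_mul]

theorem insertion_tparity {θ : V.T →ₗ[K] V} (hθ : IsCochain V V 1 θ) (X : V.T) :
    V.insertion 1 θ (V.tparity X) = - V.tparity (V.insertion 1 θ X) := by
  have hθ' : ∀ X, θ (V.tparity X) = - V.parity (θ X) := fun X => by
    simpa using hθ.parity_comm X
  refine LinearMap.congr_fun (f := V.insertion 1 θ ∘ₗ V.tparity)
    (g := - (V.tparity ∘ₗ V.insertion 1 θ)) (ext_letter (by simp) ?_) X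
  intro X x h
  simp only [LinearMap.comp_apply, LinearMap.neg_apply] at h ⊢
  have h2 : V.insertLast 1 θ (V.tparity (X * V.letter x)) =
      - V.tparity (V.insertLast 1 θ (X * V.letter x)) := by
    simp only [insertLast, tsign_one, LinearMap.comp_apply, halfCoshuffle_tparity]
    generalize V.halfCoshuffle _ = z
    induction z with
    | zero => simp
    | add a b ha hb => simp only [map_add, ha, hb, neg_add]
    | tmul a b => simp [hθ']
  rw [tparity_mul, tparity_letter, insertion_mul, h, ← tparity_letter, ← tparity_mul, h2,
    insertion_mul, map_add, tparity_mul, neg_add, neg_mul]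

variable [CharZero K]

/-- A word is recovered from its half coshuffle coproduct. -/
theorem mul'_ιInv_halfCoshuffle (X : V.T) :
    LinearMap.mul' K V.T (TensorProduct.map LinearMap.id (V.letter ∘ₗ TensorAlgebra.ιInv)
      (V.halfCoshuffle X)) = X - V.counit X • 1 := by
  refine LinearMap.congr_fun (f := LinearMap.mul' K V.T ∘ₗ
    TensorProduct.map LinearMap.id (V.letter ∘ₗ TensorAlgebra.ιInv) ∘ₗ V.halfCoshuffle)
    (g := LinearMap.id - V.counit.toLinearMap.smulRight 1) (ext_letter (by simp) ?_) X
  intro X x _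
  simp only [LinearMap.comp_apply, map_halfCoshuffle_mul, LinearMap.sub_apply, LinearMap.id_apply,
    LinearMap.smulRight_apply, AlgHom.toLinearMap_apply, counit_mul_letter, zero_smul, sub_zero]
  conv_rhs => rw [← mul'_counit_right X]
  generalize V.coshuffle X = z
  induction z with
  | zero => simp
  | add a b ha hb => simp only [map_add, ha, hb, add_mul]
  | tmul a b =>
    simp only [TensorProduct.map_tmul, LinearMap.mul'_apply, LinearMap.comp_apply,
      ιInv_mul_letter, mulLetter_apply, LinearMap.id_apply, AlgHom.toLinearMap_apply,
      Algebra.linearMap_apply, map_smul, mul_assoc, ← Algebra.smul_def]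

/-- The common step of the two compatibilities below. -/
theorem map_coshuffle_coassoc (F G : V.T →ₗ[K] W.T) (k : V.T →ₗ[K] W.T) (X : V.T) :
    TensorProduct.map LinearMap.id (LinearMap.mul' K W.T) (TensorProduct.assoc K W.T W.T W.T
      (TensorProduct.map (TensorProduct.map F G ∘ₗ V.coshuffle) k (V.coshuffle X))) =
    TensorProduct.map F (LinearMap.mul' K W.T ∘ₗ TensorProduct.map G k ∘ₗ V.coshuffle)
      (V.coshuffle X) := by
  rw [← map_mul'_assoc, ← coshuffle_coassoc, map_comp_apply, LinearMap.comp_id]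

theorem coshuffle_barMap_of {f : V.T →ₗ[K] W} (hf : IsCochain V W 0 f) {X : V.T}
    (h : W.halfCoshuffle (barMap f X) =
      TensorProduct.map (barMap f) (barMap f) (V.halfCoshuffle X)) :
    W.coshuffle (barMap f X) = TensorProduct.map (barMap f) (barMap f) (V.coshuffle X) := by
  rw [coshuffle_eq, coshuffle_eq (V := V), h, flip_map (barMap_tparity hf), counit_barMap]
  simp

theorem halfCoshuffle_barMap {f : V.T →ₗ[K] W} (hf : IsCochain V W 0 f) (X : V.T) :
    W.halfCoshuffle (barMap f X) =
      TensorProduct.map (barMap f) (barMap f) (V.halfCoshuffle X) := by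
  have key : ∀ n, V.fil n ≤ LinearMap.eqLocus (W.halfCoshuffle ∘ₗ barMap f)
      (TensorProduct.map (barMap f) (barMap f) ∘ₗ V.halfCoshuffle) := by
    intro n
    induction n with
    | zero => exact fil_zero_le (by simp)
    | succ n ih =>
      refine fil_succ_le ih fun X hX x => ?_
      have ih' : ∀ Y ∈ V.fil n, W.coshuffle (barMap f Y) =
          TensorProduct.map (barMap f) (barMap f) (V.coshuffle Y) :=
        fun Y hY => coshuffle_barMap_of hf (ih hY)
      have hk : LinearMap.mul' K W.T ∘ₗ TensorProduct.map (barMap f)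
          (W.letter ∘ₗ f ∘ₗ V.mulLetter x) ∘ₗ V.coshuffle = barMap f ∘ₗ V.mulLetter x := by
        ext Y
        simp only [LinearMap.comp_apply, mulLetter_apply]
        rw [barMap_mul, map_halfCoshuffle_mul]
        rfl
      rw [LinearMap.mem_eqLocus, LinearMap.comp_apply, LinearMap.comp_apply, barMap_mul,
        halfCoshuffle_mul'_letter, map_halfCoshuffle_mul, map_halfCoshuffle_mul,
        filT_congr (B := TensorProduct.map (barMap f) (barMap f) ∘ₗ V.coshuffle) _
          (fun Y hY => ih' Y hY) (coshuffle_mem_filT hX), map_coshuffle_coassoc, ← hk]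
      rfl
  obtain ⟨n, hn⟩ := exists_mem_fil X
  exact key n hn

/-- `D ⊗ 1 + 1 ⊗ D` on `T(V) ⊗ T(V)` for an operator `D` of odd degree. -/
noncomputable def oddLeibniz (D : V.T →ₗ[K] V.T) : V.T ⊗[K] V.T →ₗ[K] V.T ⊗[K] V.T :=
  TensorProduct.map D LinearMap.id + TensorProduct.map V.tparity D

theorem flip_oddLeibniz {D : V.T →ₗ[K] V.T} (hD : ∀ X, D (V.tparity X) = - V.tparity (D X))
    (z : V.T ⊗[K] V.T) : V.flip (oddLeibniz D z) = oddLeibniz D (V.flip z) := by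
  induction z with
  | zero => simp
  | add a b ha hb => simp only [map_add, ha, hb]
  | tmul a b =>
    simp only [oddLeibniz, LinearMap.add_apply, TensorProduct.map_tmul, map_add, flip_tmul,
      LinearMap.id_apply, map_smul, map_sub, hD, tparity_tparity, TensorProduct.add_tmul,
      TensorProduct.sub_tmul, TensorProduct.neg_tmul, TensorProduct.tmul_neg]
    module

theorem coshuffle_insertion_of {θ : V.T →ₗ[K] V} (hθ : IsCochain V V 1 θ) {X : V.T}
    (h : V.halfCoshuffle (V.insertion 1 θ X) = oddLeibniz (V.insertion 1 θ) (V.halfCoshuffle X)) :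
    V.coshuffle (V.insertion 1 θ X) = oddLeibniz (V.insertion 1 θ) (V.coshuffle X) := by
  rw [coshuffle_eq, coshuffle_eq X, h, flip_oddLeibniz (insertion_tparity hθ), counit_insertion]
  simp only [oddLeibniz, LinearMap.add_apply, map_add, zero_smul, map_smul,
    TensorProduct.map_tmul, insertion_one, TensorProduct.zero_tmul, TensorProduct.tmul_zero,
    add_zero, smul_zero]

theorem halfCoshuffle_insertion {θ : V.T →ₗ[K] V} (hθ : IsCochain V V 1 θ) (X : V.T) :
    V.halfCoshuffle (V.insertion 1 θ X) = oddLeibniz (V.insertion 1 θ) (V.halfCoshuffle X) := by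
  refine LinearMap.congr_fun (f := V.halfCoshuffle ∘ₗ V.insertion 1 θ)
    (g := oddLeibniz (V.insertion 1 θ) ∘ₗ V.halfCoshuffle) (ext_letter (by simp) ?_) X
  intro X x h
  have h' := coshuffle_insertion_of hθ h
  simp only [LinearMap.comp_apply]
  have hτ : V.coshuffle ∘ₗ V.tparity = TensorProduct.map V.tparity V.tparity ∘ₗ V.coshuffle :=
    LinearMap.ext coshuffle_tparity
  have hk : LinearMap.mul' K V.T ∘ₗ TensorProduct.map V.tparity
      (V.letter ∘ₗ θ ∘ₗ V.mulLetter x) ∘ₗ V.coshuffle = V.insertLast 1 θ ∘ₗ V.mulLetter x := by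
    ext Y
    simp only [LinearMap.comp_apply, mulLetter_apply]
    rw [insertLast_mul, tsign_one]
  rw [insertion_mul, map_add, halfCoshuffle_mul, h', insertLast_mul, tsign_one,
    halfCoshuffle_mul'_letter, hτ, map_coshuffle_coassoc, hk, halfCoshuffle_mul]
  generalize V.coshuffle X = z
  induction z with
  | zero => simp
  | add a b ha hb => simp only [map_add, ← ha, ← hb]; abel
  | tmul a b =>
    simp [oddLeibniz, insertion_mul, TensorProduct.tmul_add, add_assoc]

/-- If `f ∘ D_θ = θ' ∘ F` then `F ∘ D_θ = D_θ' ∘ F`, where `F` is the extension of `f` to words. -/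
theorem barMap_insertion {f : V.T →ₗ[K] W} (hf : IsCochain V W 0 f) {θ : V.T →ₗ[K] V}
    (hθ : IsCochain V V 1 θ) {θ' : W.T →ₗ[K] W} (hθ' : IsCochain W W 1 θ')
    (h : ∀ X, f (V.insertion 1 θ X) = θ' (barMap f X)) (X : V.T) :
    barMap f (V.insertion 1 θ X) = W.insertion 1 θ' (barMap f X) := by
  rw [← sub_eq_zero]
  refine eq_zero_of_rec (G := barMap f ∘ₗ V.insertion 1 θ - W.insertion 1 θ' ∘ₗ barMap f)
    (k := W.letter ∘ₗ f) (by simp) ?_ X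
  intro X x
  have hrec := mul'_ιInv_halfCoshuffle (V := W)
    (barMap f (V.insertion 1 θ (X * V.letter x)) - W.insertion 1 θ' (barMap f (X * V.letter x)))
  rw [map_sub W.counit, counit_barMap, counit_insertion, counit_insertion, sub_self, zero_smul,
    sub_zero] at hrec
  rw [LinearMap.sub_apply, LinearMap.comp_apply, LinearMap.comp_apply, ← hrec, map_sub,
    halfCoshuffle_barMap hf, halfCoshuffle_insertion hθ, halfCoshuffle_insertion hθ',
    halfCoshuffle_barMap hf]
  generalize V.halfCoshuffle _ = z
  induction z with
  | zero => simp
  | add a b ha hb => simp only [map_add, ← ha, ← hb]; simp only [map_add, map_sub]; abel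
  | tmul a b =>
    simp [oddLeibniz, ιInv_barMap hf.map_one, ιInv_insertion hθ'.map_one, h,
      barMap_tparity hf, sub_mul]

theorem barMap_ιInv (X : V.T) : barMap (W := V) TensorAlgebra.ιInv X = X := by
  refine LinearMap.congr_fun (g := LinearMap.id) (eq_of_rec
    (k := V.letter ∘ₗ TensorAlgebra.ιInv) (by simp) (barMap_mul _) ?_) X
  intro X x
  simp [mul'_ιInv_halfCoshuffle]

theorem barMap_comp {f : V.T →ₗ[K] W} (hf : IsCochain V W 0 f) {g : W.T →ₗ[K] Z}
    (hg : IsCochain W Z 0 g) (X : V.T) :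
    barMap (g ∘ₗ barMap f) X = barMap g (barMap f X) := by
  refine LinearMap.congr_fun (g := barMap g ∘ₗ barMap f) (eq_of_rec
    (k := Z.letter ∘ₗ g ∘ₗ barMap f) (by simp) (barMap_mul _) ?_) X
  intro X x
  have hrec := mul'_ιInv_halfCoshuffle (V := Z) (barMap g (barMap f (X * V.letter x)))
  rw [counit_barMap, counit_barMap, counit_mul_letter, zero_smul, sub_zero] at hrec
  rw [LinearMap.comp_apply, ← hrec, halfCoshuffle_barMap hg, halfCoshuffle_barMap hf,
    map_comp_apply, map_comp_apply]
  congr 3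
  ext Y
  simp [ιInv_barMap hg.map_one]

end BarCategory

section Degrees

variable {V W Z : GradedSpace.{w, u} K}

/-- The part of total degree `n` of `T(V) ⊗ T(V)`. -/
def wordsT (V : GradedSpace.{w, u} K) (n : ℤ) : Submodule K (V.T ⊗[K] V.T) :=
  Submodule.span K {z | ∃ i j : ℤ, i + j = n ∧ ∃ a ∈ V.words i, ∃ b ∈ V.words j, z = a ⊗ₜ b}

theorem tmul_mem_wordsT {i j : ℤ} {a b : V.T} (ha : a ∈ V.words i) (hb : b ∈ V.words j) :
    a ⊗ₜ b ∈ V.wordsT (i + j) :=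
  Submodule.subset_span ⟨i, j, rfl, a, ha, b, hb, rfl⟩

theorem map_mem_of_wordsT {M : Type*} [AddCommMonoid M] [Module K M] {n : ℤ}
    (F : V.T ⊗[K] V.T →ₗ[K] M) (P : Submodule K M)
    (h : ∀ i j : ℤ, i + j = n → ∀ a ∈ V.words i, ∀ b ∈ V.words j, F (a ⊗ₜ b) ∈ P)
    {z : V.T ⊗[K] V.T} (hz : z ∈ V.wordsT n) : F z ∈ P := by
  refine (Submodule.span_le (p := P.comap F)).mpr ?_ hz
  rintro _ ⟨i, j, hij, a, ha, b, hb, rfl⟩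
  exact h i j hij a ha b hb

theorem tparity_mem_words {n : ℤ} {X : V.T} (hX : X ∈ V.words n) : V.tparity X ∈ V.words n := by
  rw [tparity_words hX]; exact Submodule.smul_mem _ _ hX

theorem coshuffle_mem_wordsT {n : ℤ} {X : V.T} (hX : X ∈ V.words n) :
    V.coshuffle X ∈ V.wordsT n := by
  refine words_le (fun n => (V.wordsT n).comap V.coshuffle) ?_ ?_ hX
  · simpa using tmul_mem_wordsT one_mem_words one_mem_words
  · intro n d X _ hX x hx
    rw [Submodule.mem_comap, coshuffle_mul]
    refine map_mem_of_wordsT _ _ ?_ hX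
    rintro i j rfl a ha b hb
    rw [coshuffleStep_tmul]
    have he : V.evenPart x ∈ V.piece d := by
      simp only [evenPart, LinearMap.smul_apply, LinearMap.add_apply, LinearMap.id_apply,
        V.parity_apply hx]
      exact Submodule.smul_mem _ _ (add_mem hx (Submodule.smul_mem _ _ hx))
    have ho : V.oddPart x ∈ V.piece d := by
      simp only [oddPart, LinearMap.smul_apply, LinearMap.sub_apply, LinearMap.id_apply,
        V.parity_apply hx]
      exact Submodule.smul_mem _ _ (sub_mem hx (Submodule.smul_mem _ _ hx))
    have e1 : i + j + d = (i + d) + j := by ring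
    have e2 : i + j + d = i + (j + d) := by ring
    refine add_mem (add_mem ?_ ?_) ?_
    · rw [e1]; exact tmul_mem_wordsT (mul_letter_mem_words ha he) hb
    · rw [e1]; exact tmul_mem_wordsT (mul_letter_mem_words ha ho) (tparity_mem_words hb)
    · rw [e2]; exact tmul_mem_wordsT ha (mul_letter_mem_words hb hx)

theorem halfCoshuffle_mem_wordsT {n : ℤ} {X : V.T} (hX : X ∈ V.words n) :
    V.halfCoshuffle X ∈ V.wordsT n := by
  refine words_le (fun n => (V.wordsT n).comap V.halfCoshuffle) (by simp) ?_ hX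
  intro n d X hX _ x hx
  rw [Submodule.mem_comap, halfCoshuffle_mul]
  refine map_mem_of_wordsT _ _ ?_ (coshuffle_mem_wordsT hX)
  rintro i j rfl a ha b hb
  rw [add_assoc]
  simpa using tmul_mem_wordsT ha (mul_letter_mem_words hb hx)

theorem barMap_mem_words {f : V.T →ₗ[K] W} (hf : IsCochain V W 0 f) {n : ℤ} {X : V.T}
    (hX : X ∈ V.words n) : barMap f X ∈ W.words n := by
  have key : ∀ p : ℕ, ∀ n : ℤ, ∀ X ∈ V.words n, barPart f p X ∈ W.words n := by
    intro p
    induction p with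
    | zero =>
      intro n X hX
      refine words_le (fun n => (W.words n).comap (barPart f 0)) ?_ ?_ hX
      · simpa [barPart] using one_mem_words
      · intro n d X _ _ x _
        rw [Submodule.mem_comap, barPart, LinearMap.comp_apply, AlgHom.toLinearMap_apply,
          counit_mul_letter, map_zero]
        exact zero_mem _
    | succ p ih =>
      intro n X hX
      rw [barPart]
      refine map_mem_of_wordsT (LinearMap.mul' K W.T ∘ₗ
        TensorProduct.map (barPart f p) (W.letter ∘ₗ f)) _ ?_ (halfCoshuffle_mem_wordsT hX)
      rintro i j rfl a ha b hb
      have hb' := hf.map_words j b hb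
      rw [add_zero] at hb'
      exact mul_letter_mem_words (ih i a ha) hb'
  obtain ⟨m, hm⟩ := exists_mem_fil X
  rw [barMap_apply f hm]
  exact Submodule.sum_mem _ fun p _ => key p n X hX

theorem isCochain_ιInv : IsCochain V V 0 TensorAlgebra.ιInv where
  map_one := ιInv_one
  map_words n X hX := by
    rw [add_zero]
    refine words_le (fun n => (V.piece n).comap TensorAlgebra.ιInv) (by simp) ?_ hX
    intro n d X hX _ x hx
    rw [Submodule.mem_comap, ιInv_mul_letter]
    by_cases hn : n = 0
    · subst hn; rw [zero_add]; exact Submodule.smul_mem _ _ hx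
    · rw [counit_words hn hX, zero_smul]; exact zero_mem _

theorem isCochain_comp {f : V.T →ₗ[K] W} (hf : IsCochain V W 0 f) {g : W.T →ₗ[K] Z}
    (hg : IsCochain W Z 0 g) : IsCochain V Z 0 (g ∘ₗ barMap f) where
  map_one := by simp [hg.map_one]
  map_words n X hX := hg.map_words n _ (barMap_mem_words hf hX)

end Degrees

end GradedSpace

namespace LeibnizInfinityAlgebra

variable {K : Type w} [Field K]

/-- The composite of `f` and `g` is
`(g ∘ f)(x₁, …, xₙ) = ∑ ε(σ) g_p(f_{k₁}(x_{σ(1)}, …), …, f_{k_p}(…, x_{σ(n)}))`. -/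
noncomputable instance [CharZero K] :
    CategoryTheory.Category (LeibnizInfinityAlgebra.{w, u} K) where
  Hom := Hom
  id A :=
    { toLinearMap := TensorAlgebra.ιInv
      isCochain := isCochain_ιInv
      map_θ := by
        ext X
        simp only [LinearMap.comp_apply]
        rw [ιInv_insertion A.isMaurerCartan.isCochain.map_one, barMap_ιInv] }
  comp {A B C} f g :=
    { toLinearMap := g.toLinearMap ∘ₗ barMap f.toLinearMap
      isCochain := isCochain_comp f.isCochain g.isCochain
      map_θ := by
        ext X
        have hg := LinearMap.congr_fun g.map_θ
        simp only [LinearMap.comp_apply] at hg ⊢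
        rw [barMap_insertion f.isCochain A.isMaurerCartan.isCochain B.isMaurerCartan.isCochain
          (LinearMap.congr_fun f.map_θ), hg, barMap_comp f.isCochain g.isCochain] }
  id_comp {A B} f := by
    apply Hom.ext
    ext X
    simp only [LinearMap.comp_apply]
    rw [barMap_ιInv]
  comp_id {A B} f := by
    apply Hom.ext
    ext X
    simp only [LinearMap.comp_apply]
    rw [ιInv_barMap f.isCochain.map_one]
  assoc {A B C D} f g h := by
    apply Hom.ext
    ext X
    simp only [LinearMap.comp_apply]
    rw [barMap_comp f.isCochain g.isCochain]

end LeibnizInfinityAlgebra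

open CategoryTheory

/-! The tensor coalgebra `T(V)`, with the half coshuffle coproduct in which the last letter stays on
the right, behaves like a cofree object. A map `g` into `V` extends uniquely to a coderivation
`insertion n g`, and a degree `0` map `f` extends to a comorphism `barMap f`. Both are recovered
from their corestriction to letters (`ιInv`). Under this dictionary the Balavoine bracket with `Θ`
is a commutator of coderivations, and a Maurer–Cartan element is an odd coderivation of square zero.

Let `Q` be the coderivation of `Δ` on `T(𝔤 ⊕ V)`. Its square vanishes: the `𝔤`-component of the
equation is the generalized Jacobi identity and the `V`-component is the representation identity.
Graded symmetry turns "insert `l` at every place" into "insert `l` in front"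
(`IsGradedSymmetric.apply_insertion`, `hemisemidirect_insertion`).

Let `ψ` be the horizontal lift of `Θ` and `D` its coderivation. Since `ψ` reads only `V`-components
and takes values in `𝔤`, one has `ψ ∘ D = 0`. Hence `D ^ n` kills words of length less than `n`, and
`exp D` is a locally finite sum equal to the comorphism with corestriction `ιInv + ψ`
(`IsEvenCoderivation.exp_eq_barMap`). Its inverse has corestriction `ιInv - ψ`. For the same reason
the iterated brackets collapse to two terms (`adPow_succ_apply`), which gives local finiteness. The
coderivation of `e^{[·, Θ]} Δ` is therefore `exp(-D) Q exp(D)` (`insertion_expAd`). It squares to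
zero because `Q` does, which is (i).

On `T(V)` the `𝔤`-component of `e^{[·, Θ]} Δ` is the left side of the Maurer–Cartan equation of `Θ`,
since the term without `Θ` vanishes there (`projAlg_expAd_inclMod`). So `T(V)` is preserved and the
square-zero equation restricts to it, which is (ii).

For (iii), a strict homomorphism induces a degree `0` map of the direct sums that intertwines `Δ`
and `Θ`. By naturality of insertions it intertwines all iterated brackets and their exponential sum.
-/

namespace GradedSpace

variable {K : Type w} [Field K]

/-! ### Naturality of the coshuffle and of insertions under letterwise maps -/

section Naturality

universe t

variable {V : GradedSpace.{w, u} K} {W : GradedSpace.{w, v} K}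

theorem tmap_tmap {Z : GradedSpace.{w, t} K} (ψ : W →ₗ[K] Z) (φ : V →ₗ[K] W) (X : V.T) :
    tmap ψ (tmap φ X) = tmap (ψ ∘ₗ φ) X := by
  refine LinearMap.congr_fun (f := tmap ψ ∘ₗ tmap φ) (g := tmap (ψ ∘ₗ φ))
    (ext_letter (by simp) ?_) X
  intro X x h
  simp only [LinearMap.comp_apply] at h
  simp [h]

theorem tmap_zero (X : V.T) : tmap (0 : V →ₗ[K] W) X = V.counit X • 1 := by
  refine LinearMap.congr_fun (f := tmap (0 : V →ₗ[K] W))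
    (g := V.counit.toLinearMap.smulRight 1) (ext_letter (by simp) ?_) X
  intro X x _
  simp [TensorAlgebra.algebraMapInv]

/-- The Koszul signs are encoded by parity operators, so commutation with parity is all that the
naturality of coshuffles and insertions needs from degree preservation. -/
theorem map_parity_of_degree {φ : V →ₗ[K] W} (hφ : ∀ d, ∀ x ∈ V.piece d, φ x ∈ W.piece d)
    (x : V) : φ (V.parity x) = W.parity (φ x) := by
  induction x using V.piece_induction with
  | h0 => simp
  | hadd x y hx hy => simp [hx, hy]
  | h d x hx => rw [V.parity_apply hx, W.parity_apply (hφ d x hx), map_smul]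

variable {φ : V →ₗ[K] W}

theorem tmap_mem_words (hφ : ∀ d, ∀ x ∈ V.piece d, φ x ∈ W.piece d) {n : ℤ} {X : V.T}
    (hX : X ∈ V.words n) : tmap φ X ∈ W.words n := by
  refine words_le (fun n => (W.words n).comap (tmap φ)) (by simpa using one_mem_words) ?_ hX
  intro n d X _ hX x hx
  rw [Submodule.mem_comap, tmap_mul, tmap_letter]
  exact mul_letter_mem_words hX (hφ d x hx)

variable (hφ : ∀ x, φ (V.parity x) = W.parity (φ x))

include hφ

theorem tmap_tparity (X : V.T) : tmap φ (V.tparity X) = W.tparity (tmap φ X) := by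
  rw [tparity, tparity, tmap_tmap, tmap_tmap]
  congr 2
  ext x
  exact hφ x

theorem coshuffle_tmap (X : V.T) :
    W.coshuffle (tmap φ X) = TensorProduct.map (tmap φ) (tmap φ) (V.coshuffle X) := by
  refine LinearMap.congr_fun (f := W.coshuffle ∘ₗ tmap φ)
    (g := TensorProduct.map (tmap φ) (tmap φ) ∘ₗ V.coshuffle) (ext_letter (by simp) ?_) X
  intro X x h
  simp only [LinearMap.comp_apply] at h
  simp only [LinearMap.comp_apply, tmap_mul, tmap_letter, coshuffle_mul, h]
  generalize V.coshuffle X = z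
  induction z with
  | zero => simp
  | add a b ha hb => simp only [map_add, ha, hb]
  | tmul a b =>
    have he : φ (V.evenPart x) = W.evenPart (φ x) := by simp [evenPart, hφ]
    have ho : φ (V.oddPart x) = W.oddPart (φ x) := by simp [oddPart, hφ]
    simp [coshuffleStep_tmul, he, ho, tmap_tparity hφ]

theorem tmap_tsign (n : ℤ) (X : V.T) : tmap φ (V.tsign n X) = W.tsign n (tmap φ X) := by
  unfold tsign
  split_ifs
  · rfl
  · exact tmap_tparity hφ X

/-- If `φ ∘ g = g' ∘ T(φ)` then `T(φ)` intertwines the extensions of `g` and `g'` to words. -/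
theorem tmap_insertion (n : ℤ) {g : V.T →ₗ[K] V} {g' : W.T →ₗ[K] W}
    (h : ∀ X, φ (g X) = g' (tmap φ X)) (X : V.T) :
    tmap φ (V.insertion n g X) = W.insertion n g' (tmap φ X) := by
  refine LinearMap.congr_fun (f := tmap φ ∘ₗ V.insertion n g)
    (g := W.insertion n g' ∘ₗ tmap φ) (ext_letter (by simp) ?_) X
  intro X x ih
  simp only [LinearMap.comp_apply] at ih ⊢
  rw [insertion_mul, map_add, tmap_mul, ih, tmap_mul, tmap_letter, insertion_mul, insertLast_mul,
    insertLast_mul, coshuffle_tmap hφ]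
  congr 1
  generalize V.coshuffle X = z
  induction z with
  | zero => simp
  | add a b ha hb => simp only [map_add, ha, hb]
  | tmul a b => simp [tmap_tsign hφ, h]

end Naturality

/-! ### Degrees of sums and insertions -/

section Cochains

variable {V : GradedSpace.{w, u} K} {W : GradedSpace.{w, v} K}

theorem IsCochain.add {m : ℤ} {f g : V.T →ₗ[K] W} (hf : IsCochain V W m f)
    (hg : IsCochain V W m g) : IsCochain V W m (f + g) where
  map_one := by simp [hf.map_one, hg.map_one]
  map_words n X hX := add_mem (hf.map_words n X hX) (hg.map_words n X hX)

theorem IsCochain.neg {m : ℤ} {f : V.T →ₗ[K] W} (hf : IsCochain V W m f) :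
    IsCochain V W m (-f) where
  map_one := by simp [hf.map_one]
  map_words n X hX := neg_mem (hf.map_words n X hX)

theorem IsCochain.sub {m : ℤ} {f g : V.T →ₗ[K] W} (hf : IsCochain V W m f)
    (hg : IsCochain V W m g) : IsCochain V W m (f - g) where
  map_one := by simp [hf.map_one, hg.map_one]
  map_words n X hX := sub_mem (hf.map_words n X hX) (hg.map_words n X hX)

theorem tsign_mem_words (m : ℤ) {n : ℤ} {X : V.T} (hX : X ∈ V.words n) :
    V.tsign m X ∈ V.words n := by
  unfold tsign
  split_ifs
  · exact hX
  · exact tparity_mem_words hX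

theorem insertion_mem_words {m : ℤ} {g : V.T →ₗ[K] V} (hg : IsCochain V V m g) {n : ℤ} {X : V.T}
    (hX : X ∈ V.words n) : V.insertion m g X ∈ V.words (n + m) := by
  refine words_le (fun n => (V.words (n + m)).comap (V.insertion m g)) (by simp) ?_ hX
  intro n d X hX ih x hx
  rw [Submodule.mem_comap, insertion_mul]
  refine add_mem ?_ ?_
  · rw [add_right_comm]; exact mul_letter_mem_words ih hx
  · refine map_mem_of_wordsT (LinearMap.mul' K V.T ∘ₗ
      TensorProduct.map (V.tsign m) (V.letter ∘ₗ g)) _ ?_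
      (halfCoshuffle_mem_wordsT (mul_letter_mem_words hX hx))
    intro i j hij a ha b hb
    rw [← hij, add_assoc]
    exact mul_letter_mem_words (tsign_mem_words m ha) (hg.map_words j b hb)

theorem IsCochain.comp_insertion {k m : ℤ} {f : V.T →ₗ[K] W} {g : V.T →ₗ[K] V}
    (hf : IsCochain V W k f) (hg : IsCochain V V m g) :
    IsCochain V W (m + k) (f ∘ₗ V.insertion m g) where
  map_one := by simp
  map_words n X hX := by
    rw [← add_assoc]
    exact hf.map_words _ _ (insertion_mem_words hg hX)

theorem IsCochain.of_parts {f : V.T →ₗ[K] W} {m : ℤ} (h1 : f 1 = 0)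
    (h : ∀ n d : ℤ, ∀ X ∈ V.words n, ∀ x ∈ V.piece d, f (X * V.letter x) ∈ W.piece (n + d + m)) :
    IsCochain V W m f where
  map_one := h1
  map_words n X hX := words_le (fun n => (W.piece (n + m)).comap f) (by simp [h1])
    (fun n d X hX _ x hx => h n d X hX x hx) hX

end Cochains

/-! ### Coderivations of the half coshuffle coproduct -/

section Coderivations

variable {V : GradedSpace.{w, u} K}

theorem tsign_zero : V.tsign 0 = LinearMap.id := by simp [tsign]

theorem insertion_zero_right (n : ℤ) : V.insertion n (0 : V.T →ₗ[K] V) = 0 := by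
  refine ext_letter (by simp) ?_
  intro X x h
  rw [insertion_mul, h]
  simp [insertLast]

theorem insertion_zero_tparity {ψ : V.T →ₗ[K] V} (hψ : IsCochain V V 0 ψ) (X : V.T) :
    V.insertion 0 ψ (V.tparity X) = V.tparity (V.insertion 0 ψ X) := by
  have hψ' : ∀ X, ψ (V.tparity X) = V.parity (ψ X) := fun X => by simpa using hψ.parity_comm X
  -- `tparity` is `tmap` of the parity operator, so the claim is naturality of insertions applied to
  -- parity itself.
  refine (tmap_insertion (φ := V.parity) (fun _ => rfl) 0 (fun X => ?_) X).symm
  exact (hψ' X).symm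

/-- `D ⊗ 1 + 1 ⊗ D` on `T(V) ⊗ T(V)` for an operator `D` of even degree. -/
noncomputable def evenLeibniz (D : V.T →ₗ[K] V.T) : Module.End K (V.T ⊗[K] V.T) :=
  TensorProduct.map D LinearMap.id + TensorProduct.map LinearMap.id D

theorem evenLeibniz_tmul (D : V.T →ₗ[K] V.T) (X Y : V.T) :
    evenLeibniz D (X ⊗ₜ Y) = D X ⊗ₜ Y + X ⊗ₜ D Y := rfl

theorem oddLeibniz_tmul (D : V.T →ₗ[K] V.T) (X Y : V.T) :
    oddLeibniz D (X ⊗ₜ Y) = D X ⊗ₜ Y + V.tparity X ⊗ₜ D Y := rfl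

/-- By `coshuffle_eq` the full coproduct is the half coproduct, plus its flip, plus a counit term. A
Leibniz rule compatible with the flip therefore passes from the half coproduct to the full one. -/
theorem flip_evenLeibniz {D : V.T →ₗ[K] V.T} (hD : ∀ X, D (V.tparity X) = V.tparity (D X))
    (z : V.T ⊗[K] V.T) : V.flip (evenLeibniz D z) = evenLeibniz D (V.flip z) := by
  induction z with
  | zero => simp
  | add a b ha hb => simp only [map_add, ha, hb]
  | tmul a b =>
    simp only [evenLeibniz_tmul, map_add, flip_tmul, map_smul, map_sub, hD,
      TensorProduct.add_tmul, TensorProduct.sub_tmul]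
    module

/-- Coderivations of odd degree of `T(V)` with respect to the half coshuffle coproduct. -/
structure IsOddCoderivation (Q : V.T →ₗ[K] V.T) : Prop where
  map_one : Q 1 = 0
  counit : ∀ X, V.counit (Q X) = 0
  leibniz : ∀ X, V.halfCoshuffle (Q X) = oddLeibniz Q (V.halfCoshuffle X)

/-- Coderivations of even degree of `T(V)` with respect to the half coshuffle coproduct. -/
structure IsEvenCoderivation (D : V.T →ₗ[K] V.T) : Prop where
  map_one : D 1 = 0
  counit : ∀ X, V.counit (D X) = 0
  leibniz : ∀ X, V.halfCoshuffle (D X) = evenLeibniz D (V.halfCoshuffle X)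

variable [CharZero K]

theorem isOddCoderivation_insertion {θ : V.T →ₗ[K] V} (hθ : IsCochain V V 1 θ) :
    IsOddCoderivation (V.insertion 1 θ) :=
  ⟨insertion_one _ _, counit_insertion _ _, halfCoshuffle_insertion hθ⟩

/-- Induction on the last letter `x`. The half coproduct of `X ⊗ x` is the full coproduct of `X`
with `x` appended on the right, so the induction hypothesis is first upgraded to the full coproduct.
The terms in which `ψ` absorbs `x` are handled by coassociativity. -/
theorem isEvenCoderivation_insertion {ψ : V.T →ₗ[K] V} (hψ : IsCochain V V 0 ψ) :
    IsEvenCoderivation (V.insertion 0 ψ) := by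
  refine ⟨insertion_one _ _, counit_insertion _ _, fun X => ?_⟩
  refine LinearMap.congr_fun (f := V.halfCoshuffle ∘ₗ V.insertion 0 ψ)
    (g := evenLeibniz (V.insertion 0 ψ) ∘ₗ V.halfCoshuffle) (ext_letter (by simp) ?_) X
  intro X x h
  simp only [LinearMap.comp_apply] at h ⊢
  have h' : V.coshuffle (V.insertion 0 ψ X) = evenLeibniz (V.insertion 0 ψ) (V.coshuffle X) := by
    rw [coshuffle_eq, coshuffle_eq X, h, flip_evenLeibniz (insertion_zero_tparity hψ),
      counit_insertion]
    simp only [map_add, zero_smul, map_smul, evenLeibniz_tmul, insertion_one,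
      TensorProduct.zero_tmul, TensorProduct.tmul_zero, add_zero, smul_zero]
  -- The identity plays the role that the sign operator `tparity` has in odd degree; in this form
  -- `map_coshuffle_coassoc` applies.
  have hτ : V.coshuffle ∘ₗ LinearMap.id =
      TensorProduct.map LinearMap.id LinearMap.id ∘ₗ V.coshuffle := by
    rw [TensorProduct.map_id]; rfl
  have hk : LinearMap.mul' K V.T ∘ₗ TensorProduct.map LinearMap.id
      (V.letter ∘ₗ ψ ∘ₗ V.mulLetter x) ∘ₗ V.coshuffle = V.insertLast 0 ψ ∘ₗ V.mulLetter x := by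
    ext Y
    simp only [LinearMap.comp_apply, mulLetter_apply]
    rw [insertLast_mul, tsign_zero]
  rw [insertion_mul, map_add, halfCoshuffle_mul, h', insertLast_mul, tsign_zero,
    halfCoshuffle_mul'_letter, hτ, map_coshuffle_coassoc, hk, halfCoshuffle_mul]
  generalize V.coshuffle X = z
  induction z with
  | zero => simp
  | add a b ha hb => simp only [map_add, ← ha, ← hb]; abel
  | tmul a b =>
    simp [evenLeibniz_tmul, insertion_mul, TensorProduct.tmul_add, add_assoc]

/-- An operator on words is recovered from its half coshuffle coproduct. -/
theorem mul'_ιInv_halfCoshuffle_of_counit {X : V.T} (hX : V.counit X = 0) :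
    LinearMap.mul' K V.T (TensorProduct.map LinearMap.id (V.letter ∘ₗ TensorAlgebra.ιInv)
      (V.halfCoshuffle X)) = X := by
  rw [mul'_ιInv_halfCoshuffle, hX, zero_smul, sub_zero]

/-- An odd coderivation is determined by its corestriction to letters. -/
theorem IsOddCoderivation.ext {P Q : V.T →ₗ[K] V.T} (hP : IsOddCoderivation P)
    (hQ : IsOddCoderivation Q)
    (h : ∀ X, TensorAlgebra.ιInv (P X) = TensorAlgebra.ιInv (Q X)) : P = Q := by
  rw [← sub_eq_zero]
  ext X
  -- Rebuilding a word from its half coproduct projects the right factor to letters, where `P` and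
  -- `Q` agree. What remains is `P - Q` on the left factor, which is shorter than the word.
  refine eq_zero_of_rec (G := P - Q) (k := V.letter ∘ₗ TensorAlgebra.ιInv)
    (by simp [hP.map_one, hQ.map_one]) ?_ X
  intro X x
  rw [LinearMap.sub_apply, ← mul'_ιInv_halfCoshuffle_of_counit (hP.counit _),
    ← mul'_ιInv_halfCoshuffle_of_counit (hQ.counit _), hP.leibniz, hQ.leibniz]
  generalize V.halfCoshuffle _ = z
  induction z with
  | zero => simp
  | add a b ha hb => simp only [map_add, ← ha, ← hb]; abel
  | tmul a b => simp [oddLeibniz_tmul, h, sub_mul]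

omit [CharZero K] in
-- The mixed terms, with `Q` on one factor and `D` on the other, occur in both composites and cancel
-- because `D` commutes with parity.
theorem IsOddCoderivation.commutator {Q D : V.T →ₗ[K] V.T} (hQ : IsOddCoderivation Q)
    (hD : IsEvenCoderivation D) (hDτ : ∀ X, D (V.tparity X) = V.tparity (D X)) :
    IsOddCoderivation (Q ∘ₗ D - D ∘ₗ Q) where
  map_one := by simp [hQ.map_one, hD.map_one]
  counit X := by simp [hQ.counit, hD.counit]
  leibniz X := by
    simp only [LinearMap.sub_apply, LinearMap.comp_apply, map_sub, hQ.leibniz, hD.leibniz]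
    generalize V.halfCoshuffle _ = z
    induction z with
    | zero => simp
    | add a b ha hb => simp only [map_add, ← ha, ← hb]; abel
    | tmul a b =>
      simp only [oddLeibniz_tmul, evenLeibniz_tmul, map_add, LinearMap.sub_apply,
        LinearMap.comp_apply, hDτ, TensorProduct.sub_tmul, TensorProduct.tmul_sub]
      abel

/-- The square of an odd coderivation vanishes if its corestriction to letters does. -/
theorem IsOddCoderivation.sq_eq_zero {Q : V.T →ₗ[K] V.T} (hQ : IsOddCoderivation Q)
    (hQτ : ∀ X, Q (V.tparity X) = - V.tparity (Q X))
    (h : ∀ X, TensorAlgebra.ιInv (Q (Q X)) = 0) (X : V.T) : Q (Q X) = 0 := by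
  refine eq_zero_of_rec (G := Q ∘ₗ Q) (k := V.letter ∘ₗ TensorAlgebra.ιInv)
    (by simp [hQ.map_one]) ?_ X
  intro X x
  rw [LinearMap.comp_apply, ← mul'_ιInv_halfCoshuffle_of_counit (hQ.counit _), hQ.leibniz,
    hQ.leibniz]
  generalize V.halfCoshuffle _ = z
  induction z with
  | zero => simp
  | add a b ha hb => simp only [map_add, ha, hb]
  -- The cross terms `Q (tparity a) ⊗ Q b` and `tparity (Q a) ⊗ Q b` cancel by `hQτ`; `Q (Q b)` dies
  -- under the projection to letters.
  | tmul a b => simp [oddLeibniz_tmul, h, hQτ]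

omit [CharZero K] in
/-- Conjugation of an odd coderivation by an automorphism of the half coshuffle coproduct. -/
theorem IsOddCoderivation.conj {Q F G : V.T →ₗ[K] V.T} (hQ : IsOddCoderivation Q)
    (hF1 : F 1 = 1) (hG : ∀ X, V.counit (G X) = V.counit X)
    (hFc : ∀ X, V.halfCoshuffle (F X) = TensorProduct.map F F (V.halfCoshuffle X))
    (hGc : ∀ X, V.halfCoshuffle (G X) = TensorProduct.map G G (V.halfCoshuffle X))
    (hFτ : ∀ X, F (V.tparity X) = V.tparity (F X)) (hGF : ∀ X, G (F X) = X) :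
    IsOddCoderivation (G ∘ₗ Q ∘ₗ F) where
  map_one := by simp [hF1, hQ.map_one]
  counit X := by simp only [LinearMap.comp_apply, hG, hQ.counit]
  leibniz X := by
    simp only [LinearMap.comp_apply, hGc, hQ.leibniz, hFc]
    generalize V.halfCoshuffle _ = z
    induction z with
    | zero => simp
    | add a b ha hb => simp only [map_add, ← ha, ← hb]
    -- On the factor not hit by `Q`, `G` undoes `F`; moving parity through `F` exposes `G ∘ F` on
    -- the left factor too.
    | tmul a b => simp [oddLeibniz_tmul, ← hFτ, hGF]

end Coderivations

/-! ### Exponentials of locally nilpotent even coderivations -/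

theorem pointwiseSum_apply {M N : Type*} [AddCommGroup M] [Module K M] [AddCommGroup N]
    [Module K N] {a : ℕ → M →ₗ[K] N} {X : M} {n : ℕ} (ha : PointwiseFinite a)
    (h : ∀ i, n < i → a i X = 0) : pointwiseSum a X = ∑ i ∈ Finset.range (n + 1), a i X := by
  rw [pointwiseSum, dif_pos ha]
  refine finsum_eq_sum_of_support_subset _ fun p hp => ?_
  by_contra h'
  exact hp (h p (by simpa using h'))

section Exponential

variable {V : GradedSpace.{w, u} K} [CharZero K] {D : Module.End K V.T}

omit [CharZero K] in
theorem IsEvenCoderivation.pow_leibniz (hD : IsEvenCoderivation D) (n : ℕ) (X : V.T) :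
    V.halfCoshuffle ((D ^ n) X) = (evenLeibniz D ^ n) (V.halfCoshuffle X) := by
  induction n generalizing X with
  | zero => simp
  | succ n ih => rw [pow_succ, Module.End.mul_apply, ih, hD.leibniz, pow_succ, Module.End.mul_apply]

variable {ψ : V.T →ₗ[K] V}

omit [CharZero K] in
-- In the binomial expansion of `(D ⊗ 1 + 1 ⊗ D) ^ (n + 1)` the terms with `D ^ j` on the right, `j
-- ≥ 2`, vanish after projection to letters, since `ιInv ∘ D ^ j = ψ ∘ D ^ (j - 1) = 0`. Only `j =
-- 0` and `j = 1` survive, the latter with coefficient `n + 1`.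
theorem map_ιInv_evenLeibniz_pow (hDψ : ∀ X, TensorAlgebra.ιInv (D X) = ψ X)
    (hψD : ∀ X, ψ (D X) = 0) (n : ℕ) (z : V.T ⊗[K] V.T) :
    TensorProduct.map LinearMap.id (V.letter ∘ₗ TensorAlgebra.ιInv) ((evenLeibniz D ^ (n + 1)) z) =
      TensorProduct.map (D ^ (n + 1)) (V.letter ∘ₗ TensorAlgebra.ιInv) z +
        ((n + 1 : ℕ) : K) • TensorProduct.map (D ^ n) (V.letter ∘ₗ ψ) z := by
  induction n generalizing z with
  | zero =>
    induction z with
    | zero => simp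
    | add a b ha hb => simp only [map_add, ha, hb, smul_add]; abel
    | tmul a b => simp [evenLeibniz_tmul, hDψ]
  | succ n ih =>
    rw [pow_succ, Module.End.mul_apply, ih]
    induction z with
    | zero => simp
    | add a b ha hb =>
      simp only [map_add, smul_add]
      rw [add_add_add_comm, ha, hb]; abel
    | tmul a b =>
      simp only [evenLeibniz_tmul, map_add, TensorProduct.map_tmul, LinearMap.comp_apply, hDψ, hψD,
        map_zero, TensorProduct.tmul_zero, add_zero, ← Module.End.mul_apply, ← pow_succ]
      push_cast
      module

/-- The truncated binomial formula combined with reconstruction from the half coproduct. Powers of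
`D` on the right side act only on left factors, which are shorter words, so this is a recursion on
length. -/
theorem IsEvenCoderivation.pow_mul (hD : IsEvenCoderivation D)
    (hDψ : ∀ X, TensorAlgebra.ιInv (D X) = ψ X) (hψD : ∀ X, ψ (D X) = 0) (n : ℕ) (X : V.T)
    (x : V) : (D ^ (n + 1)) (X * V.letter x) =
      LinearMap.mul' K V.T (TensorProduct.map (D ^ (n + 1)) (V.letter ∘ₗ TensorAlgebra.ιInv)
        (V.halfCoshuffle (X * V.letter x))) + ((n + 1 : ℕ) : K) • LinearMap.mul' K V.T
          (TensorProduct.map (D ^ n) (V.letter ∘ₗ ψ) (V.halfCoshuffle (X * V.letter x))) := by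
  have hc : V.counit ((D ^ (n + 1)) (X * V.letter x)) = 0 := by
    rw [pow_succ', Module.End.mul_apply, hD.counit]
  rw [← mul'_ιInv_halfCoshuffle_of_counit hc, hD.pow_leibniz, map_ιInv_evenLeibniz_pow hDψ hψD,
    map_add, map_smul]

/-- Words of length at most `N` are annihilated by `D ^ n` for `n > N`. -/
theorem IsEvenCoderivation.pow_eq_zero (hD : IsEvenCoderivation D)
    (hDψ : ∀ X, TensorAlgebra.ιInv (D X) = ψ X) (hψD : ∀ X, ψ (D X) = 0) {N : ℕ} :
    ∀ {n : ℕ}, N < n → ∀ {X : V.T}, X ∈ V.fil N → (D ^ n) X = 0 := by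
  induction N with
  | zero =>
    intro n hn X hX
    obtain ⟨n, rfl⟩ : ∃ q, n = q + 1 := ⟨n - 1, by omega⟩
    refine fil_zero_le (P := LinearMap.ker (D ^ (n + 1))) ?_ hX
    rw [LinearMap.mem_ker, pow_succ, Module.End.mul_apply, hD.map_one, map_zero]
  | succ N ih =>
    intro n hn X hX
    obtain ⟨n, rfl⟩ : ∃ q, n = q + 1 := ⟨n - 1, by omega⟩
    refine fil_succ_le (P := LinearMap.ker (D ^ (n + 1)))
      (fun Y hY => ih (by omega) hY) (fun Y hY x => ?_) hX
    rw [LinearMap.mem_ker, hD.pow_mul hDψ hψD, map_halfCoshuffle_mul, map_halfCoshuffle_mul,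
      filT_congr (B := 0) _ (fun Z hZ => ih (by omega) hZ) (coshuffle_mem_filT hY),
      filT_congr (A := D ^ n) (B := 0) _ (fun Z hZ => ih (by omega) hZ) (coshuffle_mem_filT hY)]
    simp

theorem IsEvenCoderivation.pointwiseFinite_exp (hD : IsEvenCoderivation D)
    (hDψ : ∀ X, TensorAlgebra.ιInv (D X) = ψ X) (hψD : ∀ X, ψ (D X) = 0) :
    PointwiseFinite fun n : ℕ => (n.factorial : K)⁻¹ • D ^ n := by
  intro X
  obtain ⟨N, hN⟩ := exists_mem_fil X
  refine (Finset.range (N + 1)).finite_toSet.subset fun n hn => ?_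
  by_contra h
  exact hn (by simp [hD.pow_eq_zero hDψ hψD (by simpa using h) hN])

theorem IsEvenCoderivation.exp_apply (hD : IsEvenCoderivation D)
    (hDψ : ∀ X, TensorAlgebra.ιInv (D X) = ψ X) (hψD : ∀ X, ψ (D X) = 0) {N : ℕ} {X : V.T}
    (hX : X ∈ V.fil N) : pointwiseSum (fun n : ℕ => (n.factorial : K)⁻¹ • D ^ n) X =
      ∑ n ∈ Finset.range (N + 1), ((n.factorial : K)⁻¹ • D ^ n) X :=
  pointwiseSum_apply (hD.pointwiseFinite_exp hDψ hψD) fun n hn => by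
    simp [hD.pow_eq_zero hDψ hψD hn hX]

omit [CharZero K] in
theorem map_sum_left {M N P Q ι : Type*} [AddCommMonoid M] [Module K M] [AddCommMonoid N]
    [Module K N] [AddCommMonoid P] [Module K P] [AddCommMonoid Q] [Module K Q] (s : Finset ι)
    (a : ι → M →ₗ[K] P) (k : N →ₗ[K] Q) (z : M ⊗[K] N) :
    TensorProduct.map (∑ i ∈ s, a i) k z = ∑ i ∈ s, TensorProduct.map (a i) k z := by
  classical
  induction s using Finset.induction_on with
  | empty => simp
  | insert a s ha ih => simp [Finset.sum_insert ha, TensorProduct.map_add_left, ih]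

/-- The exponential of the coderivation `D` with corestriction `ψ`, `ψ ∘ D = 0`, is the
comorphism with corestriction `ιInv + ψ`. -/
theorem IsEvenCoderivation.exp_eq_barMap (hD : IsEvenCoderivation D)
    (hDψ : ∀ X, TensorAlgebra.ιInv (D X) = ψ X) (hψD : ∀ X, ψ (D X) = 0) :
    pointwiseSum (fun n : ℕ => (n.factorial : K)⁻¹ • D ^ n) =
      barMap (TensorAlgebra.ιInv + ψ) := by
  refine eq_of_rec (k := V.letter ∘ₗ (TensorAlgebra.ιInv + ψ)) ?_ ?_ (barMap_mul _)
  · rw [hD.exp_apply hDψ hψD (one_mem_fil 0)]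
    simp
  · intro X x
    obtain ⟨N, hN⟩ := exists_mem_fil X
    -- The exponential on left factors is truncated at `D ^ (N + 1)` in the `ιInv` part and at `D ^
    -- N` in the `ψ` part. Once the terms `n = 0` are split off, `D ^ (n + 1)` is paired with `D ^
    -- n` over a common range.
    rw [hD.exp_apply hDψ hψD (mul_letter_mem_fil hN x), LinearMap.comp_add,
      TensorProduct.map_add_right, LinearMap.add_apply, map_add, map_halfCoshuffle_mul,
      map_halfCoshuffle_mul,
      filT_congr (B := ∑ n ∈ Finset.range (N + 1 + 1), (n.factorial : K)⁻¹ • D ^ n) _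
        (fun Z hZ => by
          rw [hD.exp_apply hDψ hψD (fil_mono N.le_succ hZ), LinearMap.sum_apply])
        (coshuffle_mem_filT hN),
      filT_congr (A := pointwiseSum _)
        (B := ∑ n ∈ Finset.range (N + 1), (n.factorial : K)⁻¹ • D ^ n) _
        (fun Z hZ => by rw [hD.exp_apply hDψ hψD hZ, LinearMap.sum_apply])
        (coshuffle_mem_filT hN), map_sum_left, map_sum_left, map_sum, map_sum,
      Finset.sum_range_succ', Finset.sum_range_succ' (n := N + 1), add_right_comm,
      ← Finset.sum_add_distrib]
    congr 1
    -- Termwise this is `pow_mul`, with `(n + 1) / (n + 1)! = 1 / n!` in the `ψ` part.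
    · refine Finset.sum_congr rfl fun n _ => ?_
      rw [LinearMap.smul_apply, hD.pow_mul hDψ hψD, smul_add, smul_smul, map_halfCoshuffle_mul,
        map_halfCoshuffle_mul, TensorProduct.map_smul_left, TensorProduct.map_smul_left,
        LinearMap.smul_apply, LinearMap.smul_apply, map_smul, map_smul, Nat.factorial_succ]
      congr 2
      have h1 : ((n + 1 : ℕ) : K) ≠ 0 := by exact_mod_cast n.succ_ne_zero
      rw [Nat.cast_mul, mul_inv, mul_right_comm, inv_mul_cancel₀ h1, one_mul]
    · have hrec := mul'_ιInv_halfCoshuffle_of_counit (counit_mul_letter X x)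
      rw [map_halfCoshuffle_mul] at hrec
      simpa [Module.End.one_eq_id] using hrec.symm

end Exponential

/-! ### The mutually inverse comorphisms with corestrictions `ιInv + ψ` and `ιInv - ψ` -/

section TwistedDifferential

variable {V : GradedSpace.{w, u} K} [CharZero K] {ψ : V.T →ₗ[K] V}

/-- The comorphism is `exp D`, which differs from the identity by terms in the image of `D`, and `ψ`
kills that image. -/
theorem comp_barMap_of_comp_insertion (hψ : IsCochain V V 0 ψ)
    (hψψ : ∀ X, ψ (V.insertion 0 ψ X) = 0) (X : V.T) :
    ψ (barMap (TensorAlgebra.ιInv + ψ) X) = ψ X := by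
  have hD := isEvenCoderivation_insertion hψ
  obtain ⟨N, hN⟩ := exists_mem_fil X
  rw [← hD.exp_eq_barMap (ιInv_insertion hψ.map_one) hψψ,
    hD.exp_apply (ιInv_insertion hψ.map_one) hψψ hN, map_sum, Finset.sum_range_succ',
    Finset.sum_eq_zero fun n _ => ?_]
  · simp
  · rw [LinearMap.smul_apply, map_smul, pow_succ', Module.End.mul_apply, hψψ, smul_zero]

/-- A composite of comorphisms is the comorphism of the composite corestriction. Here that is `(ιInv
+ ψ) - ψ = ιInv`, whose comorphism is the identity. -/
theorem barMap_sub_barMap_add (hψ : IsCochain V V 0 ψ)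
    (hψψ : ∀ X, ψ (V.insertion 0 ψ X) = 0) (X : V.T) :
    barMap (TensorAlgebra.ιInv - ψ) (barMap (TensorAlgebra.ιInv + ψ) X) = X := by
  rw [← barMap_comp (isCochain_ιInv.add hψ) (isCochain_ιInv.sub hψ)]
  conv_rhs => rw [← barMap_ιInv X]
  congr 2
  ext Y
  rw [LinearMap.comp_apply, LinearMap.sub_apply,
    ιInv_barMap (by simp [hψ.map_one]), comp_barMap_of_comp_insertion hψ hψψ]
  simp

end TwistedDifferential

end GradedSpace

namespace GradedSpace

variable {K : Type w} [Field K]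

/-! ### Graded symmetric maps: insertion at all places versus insertion in front -/

section GradedSymmetric

variable {V : GradedSpace.{w, u} K} {M : Type*} [AddCommGroup M] [Module K M]

/-- The largest two-sided ideal of `T(V)` on which `f` vanishes. -/
def vanishingIdeal (f : V.T →ₗ[K] M) : Submodule K V.T where
  carrier := {Z | ∀ A B, f (A * Z * B) = 0}
  add_mem' ha hb A B := by simp [mul_add, add_mul, ha A B, hb A B]
  zero_mem' A B := by simp
  smul_mem' c Z hZ A B := by simp [hZ A B]

theorem mul_mem_vanishingIdeal {f : V.T →ₗ[K] M} {Z : V.T} (hZ : Z ∈ vanishingIdeal f)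
    (A B : V.T) : A * Z * B ∈ vanishingIdeal f := by
  intro A' B'
  have := hZ (A' * A) (B * B')
  simpa only [mul_assoc] using this

theorem apply_eq_zero_of_mem_vanishingIdeal {f : V.T →ₗ[K] M} {Z : V.T}
    (hZ : Z ∈ vanishingIdeal f) : f Z = 0 := by
  simpa using hZ 1 1

/-- The letter `x` passes the letters of `Y` one at a time. Working modulo a two-sided ideal, rather
than with values of `f`, allows the induction hypothesis to be multiplied by further letters. -/
theorem IsGradedSymmetric.letter_mul_sub_mem {f : V.T →ₗ[K] M} (hf : V.IsGradedSymmetric f)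
    {d n : ℤ} {x : V} (hx : x ∈ V.piece d) {Y : V.T} (hY : Y ∈ V.words n) :
    V.letter x * Y - (-1 : K) ^ (d * n) • (Y * V.letter x) ∈ vanishingIdeal f := by
  refine words_le (fun n => (vanishingIdeal f).comap (LinearMap.mulLeft K (V.letter x) -
    (-1 : K) ^ (d * n) • LinearMap.mulRight K (V.letter x))) ?_ ?_ hY
  · simp
  · intro n e Y _ ih y hy
    simp only [Submodule.mem_comap, LinearMap.sub_apply, LinearMap.smul_apply,
      LinearMap.mulLeft_apply, LinearMap.mulRight_apply] at ih ⊢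
    have h2 : V.letter x * V.letter y - (-1 : K) ^ (d * e) • (V.letter y * V.letter x) ∈
        vanishingIdeal f := by
      intro A B
      rw [mul_sub, sub_mul, map_sub, hf d e x hx y hy, mul_smul_comm, smul_mul_assoc, map_smul,
        sub_self]
    have h3 := add_mem (mul_mem_vanishingIdeal ih 1 (V.letter y))
      ((vanishingIdeal f).smul_mem ((-1 : K) ^ (d * n)) (mul_mem_vanishingIdeal h2 Y 1))
    convert h3 using 1
    rw [mul_add d, zpow_add₀ (by norm_num), mul_smul]
    simp only [one_mul, mul_one, sub_mul, mul_sub, smul_sub, smul_mul_assoc, mul_smul_comm,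
      mul_assoc]
    abel

variable [CharZero K]

/-- Moving a letter `l(X ⊗ x)` past a word, up to graded symmetry: the terms of
`∑ ± l(X₁ ⊗ x) ⊗ X₂` and `∑ ± X₁ ⊗ l(X₂ ⊗ x)` agree. -/
theorem IsGradedSymmetric.letter_mul_sub_flip_mem {f : V.T →ₗ[K] M} (hf : V.IsGradedSymmetric f)
    {l : V.T →ₗ[K] V} (hl : IsCochain V V 1 l) {d : ℤ} {x : V} (hx : x ∈ V.piece d)
    (z : V.T ⊗[K] V.T) :
    LinearMap.mul' K V.T (TensorProduct.map (V.letter ∘ₗ l) LinearMap.id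
        (V.coshuffleStep x z - TensorProduct.map LinearMap.id (V.mulLetter x) z)) -
      LinearMap.mul' K V.T (TensorProduct.map V.tparity (V.letter ∘ₗ l ∘ₗ V.mulLetter x)
        (V.flip z)) ∈ vanishingIdeal f := by
  induction z with
  | zero => simp
  | add a b ha hb =>
    convert add_mem ha hb using 1
    simp only [map_add, map_sub]; abel
  | tmul a b =>
    induction a using words_induction with
    | h0 => simp
    | hadd a a' ha ha' =>
      convert add_mem ha ha' using 1
      simp only [map_add, map_sub, TensorProduct.add_tmul]; abel
    | h m a ha =>
      induction b using words_induction with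
      | h0 => simp
      | hadd b b' hb hb' =>
        convert add_mem hb hb' using 1
        simp only [map_add, map_sub, TensorProduct.tmul_add]; abel
      | h n b hb =>
        have hflip : V.flip (a ⊗ₜ b) = (-1 : K) ^ (m * n) • (b ⊗ₜ a) := by
          rw [flip_tmul, tparity_words ha, tparity_words hb]
          rcases Int.even_or_odd n with h | h
          · rw [h.neg_one_zpow, (h.mul_left m).neg_one_zpow, one_smul, sub_self,
              TensorProduct.zero_tmul, add_zero, ← two_smul K b, ← TensorProduct.smul_tmul',
              smul_smul, inv_mul_cancel₀ two_ne_zero]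
          · rw [mul_comm m, zpow_mul, h.neg_one_zpow, neg_one_smul, add_neg_cancel,
              TensorProduct.zero_tmul, zero_add, sub_neg_eq_add, ← two_smul K b,
              ← TensorProduct.smul_tmul', smul_smul, inv_mul_cancel₀ two_ne_zero, one_smul,
              TensorProduct.tmul_smul]
        have hlx := hl.map_words _ _ (mul_letter_mem_words ha hx)
        have key := (vanishingIdeal f).smul_mem ((-1 : K) ^ (d * n))
          (hf.letter_mul_sub_mem hlx hb)
        convert key using 1
        rw [coshuffleStep_tmul_of_mem hx a hb, hflip, TensorProduct.map_tmul, mulLetter_apply,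
          LinearMap.id_apply, add_sub_cancel_right, map_smul, map_smul, map_smul, map_smul,
          TensorProduct.map_tmul, TensorProduct.map_tmul, LinearMap.mul'_apply,
          LinearMap.mul'_apply, tparity_words hb, smul_sub, smul_smul]
        simp only [LinearMap.comp_apply, mulLetter_apply, LinearMap.id_apply, smul_mul_assoc,
          smul_smul]
        congr 2
        -- The letter `l (a ⊗ x)` has degree `m + d + 1` and crosses `b` of degree `n`. The sign
        -- `(-1) ^ (d * n)` from the coshuffle cancels the contribution of `d`, leaving `m * n` from
        -- the flip and `n` from `tparity b`.
        have h1 : (-1 : K) ≠ 0 := by norm_num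
        rw [← zpow_add₀ h1, ← zpow_add₀ h1,
          show d * n + (m + d + 1) * n = (m * n + n) + 2 * (d * n) by ring, zpow_add₀ h1 _ (2 * _),
          zpow_mul (-1 : K) 2]
        simp

/-- For a graded symmetric map, inserting `l` in all places of a word is the same as inserting it
in front. -/
theorem IsGradedSymmetric.insertion_sub_shuffleInsert_mem {f : V.T →ₗ[K] M}
    (hf : V.IsGradedSymmetric f) {l : V.T →ₗ[K] V} (hl : IsCochain V V 1 l) (X : V.T) :
    V.shuffleInsert l X - V.insertion 1 l X ∈ vanishingIdeal f := by
  have h : (vanishingIdeal f).comap (V.shuffleInsert l - V.insertion 1 l) = ⊤ := by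
    refine eq_top_of_mul_letter _ ?_ ?_
    · simp [shuffleInsert, hl.map_one]
    · intro X hX x
      rw [Submodule.mem_comap, LinearMap.sub_apply] at hX ⊢
      induction x using V.piece_induction with
      | h0 => simp
      | hadd x y hx hy =>
        convert add_mem hx hy using 1
        simp only [map_add, mul_add]; abel
      | h d x hx =>
        -- Terms in which `x` enters `l` are matched with `insertLast` here, the flip being absorbed
        -- by cocommutativity. Terms in which `x` stays outside are the induction hypothesis
        -- multiplied by `x`.
        have h1 := hf.letter_mul_sub_flip_mem hl hx (V.coshuffle X)
        rw [flip_coshuffle] at h1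
        have h2 := add_mem h1 (mul_mem_vanishingIdeal hX 1 (V.letter x))
        convert h2 using 1
        have h3 : LinearMap.mul' K V.T (TensorProduct.map (V.letter ∘ₗ l) LinearMap.id
            (TensorProduct.map LinearMap.id (V.mulLetter x) (V.coshuffle X))) =
            V.shuffleInsert l X * V.letter x := by
          simp only [shuffleInsert, LinearMap.comp_apply]
          generalize V.coshuffle X = z
          induction z with
          | zero => simp
          | add a b ha hb => simp only [map_add, ha, hb, add_mul]
          | tmul a b => simp [mul_assoc]
        rw [map_sub, map_sub, h3, insertion_mul, insertLast_mul, tsign_one, one_mul, sub_mul]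
        simp only [shuffleInsert, LinearMap.comp_apply, coshuffle_mul]
        abel
  exact (h ▸ Submodule.mem_top : X ∈ (vanishingIdeal f).comap (V.shuffleInsert l - V.insertion 1 l))

theorem IsGradedSymmetric.apply_insertion {f : V.T →ₗ[K] M} (hf : V.IsGradedSymmetric f)
    {l : V.T →ₗ[K] V} (hl : IsCochain V V 1 l) (X : V.T) :
    f (V.insertion 1 l X) = f (V.shuffleInsert l X) := by
  have := apply_eq_zero_of_mem_vanishingIdeal (hf.insertion_sub_shuffleInsert_mem hl X)
  rw [map_sub, sub_eq_zero] at this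
  exact this.symm

end GradedSymmetric

/-- In degree `1` the sign in the bracket makes `[θ, θ]` equal to twice `θ ∘̄ θ`. -/
theorem isMaurerCartan_of_comp_insertion {V : GradedSpace.{w, u} K} {θ : V.T →ₗ[K] V}
    (hθ : IsCochain V V 1 θ) (h : ∀ X, θ (V.insertion 1 θ X) = 0) : V.IsMaurerCartan θ where
  isCochain := hθ
  bracket_self := by
    ext X
    simp [balavoine, circ, h]

end GradedSpace

/-! ### The Maurer–Cartan element `Δ` on `𝔤 ⊕ V` and horizontal lifts -/

namespace LInfinityAlgebra.Representation

variable {K : Type w} [Field K] {𝔤 : LInfinityAlgebra.{w, u} K} {V : GradedSpace.{w, v} K}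
  (r : 𝔤.Representation V)

/-- The projection `𝔤 ⊕ V → 𝔤`. -/
abbrev projAlg : r.total →ₗ[K] 𝔤.space := LinearMap.fst K 𝔤.space V

/-- The projection `𝔤 ⊕ V → V`. -/
abbrev projMod : r.total →ₗ[K] V := LinearMap.snd K 𝔤.space V

/-- The inclusion `𝔤 → 𝔤 ⊕ V`. -/
abbrev inclAlg : 𝔤.space →ₗ[K] r.total := LinearMap.inl K 𝔤.space V

/-- The inclusion `V → 𝔤 ⊕ V`. -/
abbrev inclMod : V →ₗ[K] r.total := LinearMap.inr K 𝔤.space V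

theorem projAlg_degree : ∀ d, ∀ x ∈ r.total.piece d, r.projAlg x ∈ 𝔤.space.piece d :=
  fun _ _ hx => hx.1

theorem projMod_degree : ∀ d, ∀ x ∈ r.total.piece d, r.projMod x ∈ V.piece d :=
  fun _ _ hx => hx.2

theorem inclMod_degree : ∀ d, ∀ x ∈ V.piece d, r.inclMod x ∈ r.total.piece d :=
  fun _ _ hx => ⟨zero_mem _, hx⟩

theorem projAlg_hemisemidirect (X : r.total.T) :
    r.projAlg (r.hemisemidirect X) = 𝔤.l (tmap r.projAlg X) :=
  add_zero (𝔤.l (tmap r.projAlg X))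

theorem projMod_hemisemidirect (X : r.total.T) : r.projMod (r.hemisemidirect X) =
    onLast (((r.ρ ∘ₗ tmap r.projAlg).flip ∘ₗ r.projMod).flip) X :=
  zero_add (onLast (((r.ρ ∘ₗ tmap r.projAlg).flip ∘ₗ r.projMod).flip) X)

theorem projMod_hemisemidirect_one : r.projMod (r.hemisemidirect 1) = 0 := by
  rw [projMod_hemisemidirect, onLast_one]

theorem projMod_hemisemidirect_mul (X : r.total.T) (x : r.total) :
    r.projMod (r.hemisemidirect (X * r.total.letter x)) =
      r.ρ (tmap r.projAlg X) (r.projMod x) := by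
  rw [projMod_hemisemidirect, onLast_mul]
  rfl

theorem isCochain_hemisemidirect : IsCochain r.total r.total 1 r.hemisemidirect := by
  refine IsCochain.of_parts ?_ ?_
  · refine Prod.ext ?_ r.projMod_hemisemidirect_one
    refine (r.projAlg_hemisemidirect 1).trans ?_
    rw [tmap_one, 𝔤.isCochain.map_one]; rfl
  · intro n d X hX x hx
    refine ⟨?_, ?_⟩
    · have := 𝔤.isCochain.map_words _ _
        (tmap_mem_words r.projAlg_degree (mul_letter_mem_words hX hx))
      rwa [← r.projAlg_hemisemidirect] at this
    · have := r.degree n d _ (tmap_mem_words r.projAlg_degree hX) _ (r.projMod_degree d x hx)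
      rwa [← r.projMod_hemisemidirect_mul] at this

theorem horizontalLift_apply (a : V.T →ₗ[K] 𝔤.space) (X : r.total.T) :
    r.horizontalLift a X = r.inclAlg (a (tmap r.projMod X)) := rfl

theorem isCochain_horizontalLift {a : V.T →ₗ[K] 𝔤.space} {m : ℤ} (ha : IsCochain V 𝔤.space m a) :
    IsCochain r.total r.total m (r.horizontalLift a) where
  map_one := by rw [horizontalLift_apply, tmap_one, ha.map_one, map_zero]
  map_words n X hX :=
    ⟨ha.map_words _ _ (tmap_mem_words r.projMod_degree hX), zero_mem _⟩

/-- A horizontal lift reads only `V`-components, and after projection to `V` the inserted lift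
becomes `0`. This is the source of all the nilpotency below. -/
theorem horizontalLift_insertion_horizontalLift (a b : V.T →ₗ[K] 𝔤.space) (n : ℤ)
    (X : r.total.T) :
    r.horizontalLift a (r.total.insertion n (r.horizontalLift b) X) = 0 := by
  have h := tmap_insertion (φ := r.projMod) (map_parity_of_degree r.projMod_degree) n
    (g := r.horizontalLift b) (g' := 0) (fun _ => rfl) X
  rw [insertion_zero_right, LinearMap.zero_apply] at h
  rw [horizontalLift_apply, h, map_zero, map_zero]

variable [CharZero K]

/-- The element `∑_k l_k ⊞ ρ_k` is a Maurer-Cartan element. -/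
theorem hemisemidirect_insertion (X : r.total.T) :
    r.hemisemidirect (r.total.insertion 1 r.hemisemidirect X) = 0 := by
  have hp := map_parity_of_degree r.projAlg_degree
  have hfst : ∀ X, tmap r.projAlg (r.total.insertion 1 r.hemisemidirect X) =
      𝔤.space.insertion 1 𝔤.l (tmap r.projAlg X) :=
    tmap_insertion hp 1 r.projAlg_hemisemidirect
  refine LinearMap.congr_fun
    (f := r.hemisemidirect ∘ₗ r.total.insertion 1 r.hemisemidirect) (g := 0)
    (ext_letter (by simp) ?_) X
  intro X x _
  refine Prod.ext ?_ ?_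
  -- The `𝔤`-component is the Jacobi identity, once symmetry of `l` has moved all insertions to the
  -- front.
  · refine (r.projAlg_hemisemidirect _).trans ?_
    rw [hfst, 𝔤.symm.apply_insertion 𝔤.isCochain]
    exact LinearMap.congr_fun 𝔤.jacobi _
  -- In the `V`-component the last letter `x` is the module element. Insertions before `x` give the
  -- `l`-terms of `action`, by symmetry of `ρ`; insertions absorbing `x` give its `ρρ`-terms.
  · have hact := LinearMap.congr_fun (LinearMap.congr_fun r.action (tmap r.projAlg X)) (r.projMod x)
    simp only [LinearMap.add_apply, LinearMap.comp_apply, LinearMap.zero_apply] at hact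
    rw [← r.symm.apply_insertion 𝔤.isCochain, coshuffle_tmap hp] at hact
    change r.projMod (r.hemisemidirect (r.total.insertion 1 r.hemisemidirect
      (X * r.total.letter x))) = 0
    rw [insertion_mul, insertLast_mul, map_add, map_add, projMod_hemisemidirect_mul, hfst,
      ← hact]
    congr 1
    generalize r.total.coshuffle X = z
    induction z with
    | zero => simp
    | add a b ha hb => simp only [map_add, ha, hb, LinearMap.add_apply]
    | tmul a b =>
      simp only [TensorProduct.map_tmul, LinearMap.mul'_apply, LinearMap.comp_apply,
        mulLetter_apply, projMod_hemisemidirect_mul, tsign_one, tmap_tparity hp,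
        Module.End.mul_apply]

/-! ### The exponential `e^{[·, Θ]} Δ` as a conjugation -/

section Twist

variable {Θ : V.T →ₗ[K] 𝔤.space} (hΘ : IsCochain V 𝔤.space 0 Θ)

omit [CharZero K] in
theorem adPow_zero : r.adPow Θ 1 0 r.hemisemidirect = r.hemisemidirect := rfl

omit [CharZero K] in
theorem adPow_succ (n : ℕ) : r.adPow Θ 1 (n + 1) r.hemisemidirect =
    r.total.balavoine 1 0 (r.adPow Θ 1 n r.hemisemidirect) (r.horizontalLift Θ) :=
  Function.iterate_succ_apply' _ _ _

omit [CharZero K] in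
theorem balavoine_one_zero_apply (W : GradedSpace.{w, u} K) (f g : W.T →ₗ[K] W) (X : W.T) :
    W.balavoine 1 0 f g X = f (W.insertion 0 g X) - g (W.insertion 1 f X) := by
  simp [balavoine, circ]

include hΘ

omit [CharZero K] in
theorem isCochain_adPow (n : ℕ) :
    IsCochain r.total r.total 1 (r.adPow Θ 1 n r.hemisemidirect) := by
  induction n with
  | zero => exact r.isCochain_hemisemidirect
  | succ n ih =>
    have h1 : IsCochain r.total r.total 1 _ :=
      ih.comp_insertion (r.isCochain_horizontalLift hΘ)
    have h2 : IsCochain r.total r.total 1 _ :=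
      (r.isCochain_horizontalLift hΘ).comp_insertion ih
    convert h1.sub h2 using 1
    ext1 X
    rw [adPow_succ, balavoine_one_zero_apply]
    rfl

/-- The Balavoine bracket with `Θ` corresponds to the commutator of coderivations. -/
theorem insertion_adPow_succ (n : ℕ) :
    r.total.insertion 1 (r.adPow Θ 1 (n + 1) r.hemisemidirect) =
      r.total.insertion 1 (r.adPow Θ 1 n r.hemisemidirect) ∘ₗ
        r.total.insertion 0 (r.horizontalLift Θ) -
      r.total.insertion 0 (r.horizontalLift Θ) ∘ₗ
        r.total.insertion 1 (r.adPow Θ 1 n r.hemisemidirect) := by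
  have hΘ' := r.isCochain_horizontalLift hΘ
  refine (isOddCoderivation_insertion (r.isCochain_adPow hΘ _)).ext
    ((isOddCoderivation_insertion (r.isCochain_adPow hΘ n)).commutator
      (isEvenCoderivation_insertion hΘ') (insertion_zero_tparity hΘ')) fun X => ?_
  rw [ιInv_insertion (r.isCochain_adPow hΘ _).map_one, adPow_succ, balavoine_one_zero_apply,
    LinearMap.sub_apply, map_sub, LinearMap.comp_apply, LinearMap.comp_apply,
    ιInv_insertion (r.isCochain_adPow hΘ _).map_one, ιInv_insertion hΘ'.map_one]

/-- Each commutator `Q D - D Q` loses its second term under `Θ`, since `Θ ∘ D = 0`; after `n`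
commutators only `Q D ^ n` remains. -/
theorem horizontalLift_insertion_adPow (n : ℕ) (X : r.total.T) :
    r.horizontalLift Θ (r.total.insertion 1 (r.adPow Θ 1 n r.hemisemidirect) X) =
      r.horizontalLift Θ (r.total.insertion 1 r.hemisemidirect
        (((r.total.insertion 0 (r.horizontalLift Θ) : Module.End K r.total.T) ^ n) X)) := by
  induction n generalizing X with
  | zero => rfl
  | succ n ih =>
    rw [r.insertion_adPow_succ hΘ, LinearMap.sub_apply, map_sub, LinearMap.comp_apply,
      LinearMap.comp_apply, r.horizontalLift_insertion_horizontalLift, sub_zero,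
      ih, pow_succ, Module.End.mul_apply]

/-- The iterated commutator is an alternating binomial sum of the terms `D ^ j Q D ^ (n + 1 - j)`,
and corestriction to letters kills those with `j ≥ 2`. The terms `j = 0, 1` are the two shown. -/
theorem adPow_succ_apply (n : ℕ) (X : r.total.T) :
    r.adPow Θ 1 (n + 1) r.hemisemidirect X =
      r.hemisemidirect (((r.total.insertion 0 (r.horizontalLift Θ) :
        Module.End K r.total.T) ^ (n + 1)) X) -
      ((n + 1 : ℕ) : K) • r.horizontalLift Θ (r.total.insertion 1 r.hemisemidirect
        (((r.total.insertion 0 (r.horizontalLift Θ) : Module.End K r.total.T) ^ n) X)) := by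
  induction n generalizing X with
  | zero => simp [adPow_succ, adPow_zero, balavoine_one_zero_apply]
  | succ n ih =>
    have hpow (D : Module.End K r.total.T) (m : ℕ) : (D ^ m) (D X) = (D ^ (m + 1)) X := by
      rw [pow_succ, Module.End.mul_apply]
    rw [adPow_succ, balavoine_one_zero_apply, ih, r.horizontalLift_insertion_adPow hΘ, hpow, hpow]
    push_cast
    module

theorem adPow_eq_zero {N n : ℕ} (hn : N + 1 < n) {X : r.total.T} (hX : X ∈ r.total.fil N) :
    r.adPow Θ 1 n r.hemisemidirect X = 0 := by
  have hΘ' := r.isCochain_horizontalLift hΘ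
  have h0 {n : ℕ} (hn : N < n) := (isEvenCoderivation_insertion hΘ').pow_eq_zero (ιInv_insertion hΘ'.map_one)
    (r.horizontalLift_insertion_horizontalLift Θ Θ 0) hn hX
  obtain ⟨n, rfl⟩ : ∃ q, n = q + 1 := ⟨n - 1, by omega⟩
  -- The second term carries one power of `D` less than the first, whence the bound `N + 1` instead
  -- of `N`.
  rw [r.adPow_succ_apply hΘ, h0 (by omega), h0 (by omega)]
  simp

theorem pointwiseFinite_adPow : PointwiseFinite fun n => r.adPow Θ 1 n r.hemisemidirect := by
  intro X
  obtain ⟨N, hN⟩ := exists_mem_fil X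
  refine (Finset.range (N + 2)).finite_toSet.subset fun n hn => ?_
  by_contra h
  exact hn (r.adPow_eq_zero hΘ (by simp only [Finset.coe_range, Set.mem_Iio] at h; omega) hN)

theorem expAd_apply {N : ℕ} {X : r.total.T} (hX : X ∈ r.total.fil N) :
    r.expAd Θ 1 r.hemisemidirect X = ∑ n ∈ Finset.range (N + 2),
      (n.factorial : K)⁻¹ • r.adPow Θ 1 n r.hemisemidirect X := by
  have hfin : PointwiseFinite fun n : ℕ =>
      (n.factorial : K)⁻¹ • r.adPow Θ 1 n r.hemisemidirect := by
    intro Y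
    have h := r.pointwiseFinite_adPow hΘ Y
    refine h.subset fun n hn h' => hn ?_
    exact (congrArg ((n.factorial : K)⁻¹ • ·) h').trans (smul_zero _)
  rw [expAd, pointwiseSum_apply (n := N + 1) hfin fun n hn => by
    rw [LinearMap.smul_apply, r.adPow_eq_zero hΘ hn hX, smul_zero]]
  rfl

/-- `e^{[·, Θ]} Δ = (Δ - Θ ∘ D_Δ) ∘ e^{D_Θ}`. -/
theorem expAd_eq (X : r.total.T) : r.expAd Θ 1 r.hemisemidirect X =
    r.hemisemidirect (barMap (TensorAlgebra.ιInv + r.horizontalLift Θ) X) -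
      r.horizontalLift Θ (r.total.insertion 1 r.hemisemidirect
        (barMap (TensorAlgebra.ιInv + r.horizontalLift Θ) X)) := by
  have hΘ' := r.isCochain_horizontalLift hΘ
  have hD := isEvenCoderivation_insertion hΘ'
  have h1 := ιInv_insertion (n := 0) hΘ'.map_one
  have h2 := r.horizontalLift_insertion_horizontalLift Θ Θ 0
  obtain ⟨N, hN⟩ := exists_mem_fil X
  rw [r.expAd_apply hΘ hN, Finset.sum_range_succ' (n := N + 1), ← hD.exp_eq_barMap h1 h2]
  conv_rhs => rw [hD.exp_apply h1 h2 (fil_mono N.le_succ hN)]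
  -- Under `Θ` the exponential is truncated one step earlier, at `D ^ N`, so that `D ^ n` there
  -- pairs with `D ^ (n + 1)` in the first term.
  conv_rhs => arg 2; rw [← hD.exp_apply h1 h2 (fil_mono N.le_succ hN), hD.exp_apply h1 h2 hN]
  rw [Finset.sum_range_succ' (n := N + 1), map_add, map_sum, map_sum, map_sum, add_sub_right_comm,
    ← Finset.sum_sub_distrib]
  congr 1
  swap
  · rw [LinearMap.smul_apply, map_smul]; rfl
  refine Finset.sum_congr rfl fun n _ => ?_
  have h3 : ((n + 1 : ℕ) : K) ≠ 0 := by exact_mod_cast n.succ_ne_zero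
  rw [r.adPow_succ_apply hΘ, smul_sub, smul_smul, Nat.factorial_succ, Nat.cast_mul, mul_inv,
    mul_right_comm, inv_mul_cancel₀ h3, one_mul]
  simp only [LinearMap.smul_apply, map_smul]

theorem isCochain_expAd : IsCochain r.total r.total 1 (r.expAd Θ 1 r.hemisemidirect) := by
  have hf := isCochain_ιInv.add (r.isCochain_horizontalLift hΘ)
  have h2 : IsCochain r.total r.total 1 _ :=
    (r.isCochain_horizontalLift hΘ).comp_insertion r.isCochain_hemisemidirect
  have h3 := r.isCochain_hemisemidirect.sub h2
  refine ⟨?_, fun n X hX => ?_⟩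
  · rw [r.expAd_eq hΘ, barMap_one]; exact h3.map_one
  · rw [r.expAd_eq hΘ]; exact h3.map_words n _ (barMap_mem_words hf hX)

/-- Both sides are odd coderivations, the right one by conjugation, so only corestrictions have to
be compared; that comparison is `expAd_eq`. -/
theorem insertion_expAd : r.total.insertion 1 (r.expAd Θ 1 r.hemisemidirect) =
    barMap (TensorAlgebra.ιInv - r.horizontalLift Θ) ∘ₗ r.total.insertion 1 r.hemisemidirect ∘ₗ
      barMap (TensorAlgebra.ιInv + r.horizontalLift Θ) := by
  have hΘ' := r.isCochain_horizontalLift hΘ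
  have hf := isCochain_ιInv.add hΘ'
  have hg := isCochain_ιInv.sub hΘ'
  have h0 := r.horizontalLift_insertion_horizontalLift Θ Θ 0
  refine (isOddCoderivation_insertion (r.isCochain_expAd hΘ)).ext
    ((isOddCoderivation_insertion r.isCochain_hemisemidirect).conj (barMap_one _)
      (counit_barMap _) (halfCoshuffle_barMap hf) (halfCoshuffle_barMap hg) (barMap_tparity hf)
      (barMap_sub_barMap_add hΘ' h0)) fun X => ?_
  rw [ιInv_insertion (r.isCochain_expAd hΘ).map_one, LinearMap.comp_apply, LinearMap.comp_apply,
    ιInv_barMap hg.map_one, LinearMap.sub_apply,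
    ιInv_insertion r.isCochain_hemisemidirect.map_one, r.expAd_eq hΘ]

/-- The inverse in the other order comes from replacing `Θ` by `-Θ`. -/
theorem barMap_add_barMap_sub (X : r.total.T) :
    barMap (TensorAlgebra.ιInv + r.horizontalLift Θ)
      (barMap (TensorAlgebra.ιInv - r.horizontalLift Θ) X) = X := by
  have h := barMap_sub_barMap_add (r.isCochain_horizontalLift hΘ.neg)
    (r.horizontalLift_insertion_horizontalLift (-Θ) (-Θ) 0) X
  have hneg : r.horizontalLift (-Θ) = -r.horizontalLift Θ := by
    ext1 Y
    rw [LinearMap.neg_apply, horizontalLift_apply, horizontalLift_apply, LinearMap.neg_apply,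
      map_neg]
  rwa [hneg, sub_neg_eq_add, ← sub_eq_add_neg] at h

/-- The left side is the corestriction of the square of `exp(-D) Q exp(D)`. The inner factors cancel
and leave `Q ∘ Q`, which vanishes because `Δ` is Maurer–Cartan. -/
theorem expAd_insertion_expAd (X : r.total.T) : r.expAd Θ 1 r.hemisemidirect
    (r.total.insertion 1 (r.expAd Θ 1 r.hemisemidirect) X) = 0 := by
  have hQ := isOddCoderivation_insertion r.isCochain_hemisemidirect
  have hsq := hQ.sq_eq_zero (insertion_tparity r.isCochain_hemisemidirect) fun X => by
    rw [ιInv_insertion r.isCochain_hemisemidirect.map_one, hemisemidirect_insertion]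
  rw [← ιInv_insertion (n := 1) (r.isCochain_expAd hΘ).map_one, r.insertion_expAd hΘ]
  simp only [LinearMap.comp_apply]
  rw [r.barMap_add_barMap_sub hΘ, hsq, map_zero, map_zero]

theorem isMaurerCartan_expAd : r.total.IsMaurerCartan (r.expAd Θ 1 r.hemisemidirect) :=
  isMaurerCartan_of_comp_insertion (r.isCochain_expAd hΘ) (r.expAd_insertion_expAd hΘ)

end Twist

/-! ### Restriction to `T(V)` and the Maurer–Cartan equation of `Θ` -/

section Restriction

omit [CharZero K] in
theorem iteratedBracket_replicate (Θ : V.T →ₗ[K] 𝔤.space) (n : ℕ) :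
    r.iteratedBracket (List.replicate n (0, Θ)) = (1, r.adPow Θ 1 n r.hemisemidirect) := by
  induction n with
  | zero => rfl
  | succ n ih =>
    rw [iteratedBracket, List.replicate_succ', List.foldl_append]
    rw [iteratedBracket] at ih
    rw [ih, adPow_succ]
    rfl

omit [CharZero K] in
-- This is the term `k = 0` of the exponential, which the Maurer–Cartan equation of `Θ` does not
-- contain.
theorem projAlg_hemisemidirect_inclMod (X : V.T) :
    r.projAlg (r.hemisemidirect (tmap r.inclMod X)) = 0 := by
  rw [projAlg_hemisemidirect, tmap_tmap, show r.projAlg ∘ₗ r.inclMod = 0 from rfl, tmap_zero,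
    map_smul, 𝔤.isCochain.map_one, smul_zero]

variable {Θ : V.T →ₗ[K] 𝔤.space} (hΘ : r.IsHomotopyEmbeddingTensor Θ)

include hΘ

/-- Restricting to `T(V)` and projecting to `𝔤` turns the iterated brackets into the derived
brackets, so the exponential series becomes the Maurer–Cartan sum of `Θ`. -/
theorem projAlg_expAd_inclMod (X : V.T) :
    r.projAlg (r.expAd Θ 1 r.hemisemidirect (tmap r.inclMod X)) = 0 := by
  obtain ⟨N, hN⟩ := exists_mem_fil (tmap r.inclMod X)
  have hder (k : ℕ) : r.derivedBracket (List.replicate k (0, Θ)) X =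
      r.projAlg (r.adPow Θ 1 k r.hemisemidirect (tmap r.inclMod X)) := by
    rw [derivedBracket, iteratedBracket_replicate]; rfl
  -- `pointwiseSum` is `0` by default on families that are not pointwise finite, so the
  -- Maurer–Cartan equation carries information only once finiteness is known.
  have hfin : PointwiseFinite fun k : ℕ => ((k + 1).factorial : K)⁻¹ •
      r.derivedBracket (List.replicate (k + 1) (0, Θ)) := by
    intro Y
    obtain ⟨M, hM⟩ := exists_mem_fil (tmap r.inclMod Y)
    refine (Finset.range (M + 1)).finite_toSet.subset fun n hn => ?_
    by_contra h
    have hn' : M + 1 < n + 1 := by simpa using h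
    refine hn ?_
    simp only [LinearMap.smul_apply]
    rw [derivedBracket, iteratedBracket_replicate]
    change _ • r.projAlg (r.adPow Θ 1 (n + 1) r.hemisemidirect (tmap r.inclMod Y)) = 0
    rw [r.adPow_eq_zero hΘ.isCochain hn' hM, map_zero, smul_zero]
  have hmc := LinearMap.congr_fun hΘ.maurerCartan X
  rw [pointwiseSum_apply (n := N) hfin fun k hk => by
    rw [LinearMap.smul_apply, hder, r.adPow_eq_zero hΘ.isCochain (by omega) hN, map_zero,
      smul_zero], LinearMap.zero_apply] at hmc
  rw [r.expAd_apply hΘ.isCochain hN, Finset.sum_range_succ' (n := N + 1), map_add, map_sum,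
    adPow_zero, map_smul, projAlg_hemisemidirect_inclMod, smul_zero, add_zero, ← hmc]
  exact Finset.sum_congr rfl fun k _ => by rw [map_smul, LinearMap.smul_apply, hder]

theorem expAd_inclMod (X : V.T) : r.expAd Θ 1 r.hemisemidirect (tmap r.inclMod X) =
    r.inclMod (r.twist Θ X) :=
  Prod.ext (r.projAlg_expAd_inclMod hΘ X) rfl

theorem isCochain_twist : IsCochain V V 1 (r.twist Θ) where
  map_one := by
    have h := (r.isCochain_expAd hΘ.isCochain).map_one
    rw [← tmap_one r.inclMod, r.expAd_inclMod hΘ] at h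
    exact (Prod.ext_iff.mp h).2
  map_words n X hX := by
    have h := (r.isCochain_expAd hΘ.isCochain).map_words n _ (tmap_mem_words r.inclMod_degree hX)
    exact h.2

/-- The inclusion of `V` intertwines the twisted map with `e^{[·, Θ]} Δ`, hence also their
insertions, and it is injective. -/
theorem isMaurerCartan_twist : V.IsMaurerCartan (r.twist Θ) := by
  refine isMaurerCartan_of_comp_insertion (r.isCochain_twist hΘ) fun X => ?_
  have h := r.expAd_insertion_expAd hΘ.isCochain (tmap r.inclMod X)
  rw [← tmap_insertion (map_parity_of_degree r.inclMod_degree) 1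
    (fun X => (r.expAd_inclMod hΘ X).symm), r.expAd_inclMod hΘ] at h
  exact (Prod.ext_iff.mp h).2

end Restriction

end LInfinityAlgebra.Representation

/-! ### Strict homomorphisms intertwine the twisted structures -/

namespace HomotopyEmbeddingTensor

variable {K : Type w} [Field K] {A B : HomotopyEmbeddingTensor.{w, u, v} K} (φ : A ⟶ B)

/-- The map `𝔤 ⊕ V → 𝔤' ⊕ V'` of a strict homomorphism. -/
def Hom.total : A.rep.total →ₗ[K] B.rep.total := φ.φ𝔤.prodMap φ.φV

theorem Hom.total_degree :
    ∀ d, ∀ x ∈ A.rep.total.piece d, Hom.total φ x ∈ B.rep.total.piece d :=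
  fun d _ hx => ⟨φ.φ𝔤_degree d _ hx.1, φ.φV_degree d _ hx.2⟩

theorem Hom.tmap_projAlg (X : A.rep.total.T) :
    tmap B.rep.projAlg (tmap (Hom.total φ) X) = tmap φ.φ𝔤 (tmap A.rep.projAlg X) := by
  rw [tmap_tmap, tmap_tmap]; rfl

theorem Hom.tmap_projMod (X : A.rep.total.T) :
    tmap B.rep.projMod (tmap (Hom.total φ) X) = tmap φ.φV (tmap A.rep.projMod X) := by
  rw [tmap_tmap, tmap_tmap]; rfl

theorem Hom.total_hemisemidirect (X : A.rep.total.T) :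
    Hom.total φ (A.rep.hemisemidirect X) = B.rep.hemisemidirect (tmap (Hom.total φ) X) := by
  refine LinearMap.congr_fun (f := Hom.total φ ∘ₗ A.rep.hemisemidirect)
    (g := B.rep.hemisemidirect ∘ₗ tmap (Hom.total φ)) (ext_letter ?_ ?_) X
  · simp [A.rep.isCochain_hemisemidirect.map_one, B.rep.isCochain_hemisemidirect.map_one]
  · intro X x _
    refine Prod.ext ?_ ?_
    · change φ.φ𝔤 (A.rep.projAlg (A.rep.hemisemidirect _)) =
        B.rep.projAlg (B.rep.hemisemidirect _)
      rw [A.rep.projAlg_hemisemidirect, B.rep.projAlg_hemisemidirect, φ.map_l, Hom.tmap_projAlg]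
    · change φ.φV (A.rep.projMod (A.rep.hemisemidirect _)) =
        B.rep.projMod (B.rep.hemisemidirect (tmap (Hom.total φ) _))
      rw [A.rep.projMod_hemisemidirect_mul, tmap_mul, tmap_letter,
        B.rep.projMod_hemisemidirect_mul, φ.map_ρ, Hom.tmap_projAlg]
      rfl

theorem Hom.total_horizontalLift (X : A.rep.total.T) :
    Hom.total φ (A.rep.horizontalLift A.Θ X) =
      B.rep.horizontalLift B.Θ (tmap (Hom.total φ) X) := by
  refine Prod.ext ?_ (map_zero φ.φV)
  change φ.φ𝔤 (A.Θ (tmap A.rep.projMod X)) = B.Θ (tmap B.rep.projMod (tmap (Hom.total φ) X))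
  rw [φ.map_Θ, Hom.tmap_projMod]

/-- The bracket is built from insertions, which are natural under degree `0` maps; so intertwining
`Δ` and `Θ` suffices. -/
theorem Hom.total_adPow (n : ℕ) (X : A.rep.total.T) :
    Hom.total φ (A.rep.adPow A.Θ 1 n A.rep.hemisemidirect X) =
      B.rep.adPow B.Θ 1 n B.rep.hemisemidirect (tmap (Hom.total φ) X) := by
  have hp := map_parity_of_degree (Hom.total_degree φ)
  induction n generalizing X with
  | zero => exact Hom.total_hemisemidirect φ X
  | succ n ih =>
    rw [A.rep.adPow_succ, B.rep.adPow_succ,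
      LInfinityAlgebra.Representation.balavoine_one_zero_apply,
      LInfinityAlgebra.Representation.balavoine_one_zero_apply, map_sub, ih,
      Hom.total_horizontalLift, tmap_insertion hp 0 (Hom.total_horizontalLift φ),
      tmap_insertion hp 1 ih]

variable [CharZero K]

theorem Hom.map_twist (X : A.space.T) :
    φ.φV (A.rep.twist A.Θ X) = B.rep.twist B.Θ (tmap φ.φV X) := by
  have hX : tmap B.rep.inclMod (tmap φ.φV X) = tmap (Hom.total φ) (tmap A.rep.inclMod X) := by
    rw [tmap_tmap, tmap_tmap]
    congr 2
    refine LinearMap.ext fun v => Prod.ext ?_ rfl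
    exact (map_zero φ.φ𝔤).symm
  change (Hom.total φ (A.rep.expAd A.Θ 1 A.rep.hemisemidirect (tmap A.rep.inclMod X))).2 =
    (B.rep.expAd B.Θ 1 B.rep.hemisemidirect (tmap B.rep.inclMod (tmap φ.φV X))).2
  rw [hX]
  -- Bounds for a word and for its image are chosen independently; truncating both series at their
  -- maximum makes them comparable term by term.
  obtain ⟨N, hN⟩ := exists_mem_fil (tmap A.rep.inclMod X)
  obtain ⟨M, hM⟩ := exists_mem_fil (tmap (Hom.total φ) (tmap A.rep.inclMod X))
  rw [A.rep.expAd_apply A.isHomotopyEmbeddingTensor.isCochain (fil_mono (le_max_left N M) hN),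
    B.rep.expAd_apply B.isHomotopyEmbeddingTensor.isCochain (fil_mono (le_max_right N M) hM),
    map_sum]
  simp only [map_smul, Hom.total_adPow]

end HomotopyEmbeddingTensor

/-! ### Homomorphisms with only a linear component -/

namespace GradedSpace

variable {K : Type w} [Field K] [CharZero K] {V W : GradedSpace.{w, u} K}

omit [CharZero K] in
theorem isCochain_comp_ιInv {φ : V →ₗ[K] W} (hφ : ∀ d, ∀ x ∈ V.piece d, φ x ∈ W.piece d) :
    IsCochain V W 0 (φ ∘ₗ TensorAlgebra.ιInv) where
  map_one := by simp
  map_words n X hX := hφ _ _ (isCochain_ιInv.map_words n X hX)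

theorem barMap_comp_ιInv (φ : V →ₗ[K] W) (X : V.T) :
    barMap (φ ∘ₗ TensorAlgebra.ιInv) X = tmap φ X := by
  refine LinearMap.congr_fun (eq_of_rec (k := W.letter ∘ₗ φ ∘ₗ TensorAlgebra.ιInv) (by simp)
    (barMap_mul _) ?_) X
  intro X x
  conv_lhs => rw [← mul'_ιInv_halfCoshuffle_of_counit (counit_mul_letter X x)]
  generalize V.halfCoshuffle _ = z
  induction z with
  | zero => simp
  | add a b ha hb => simp only [map_add, ha, hb]
  | tmul a b => simp

end GradedSpace

/-- The facts `hobj`, `hdeg`, `hmap` are quantified first because the objects and morphisms assigned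
by `S` contain them. The equation of prefunctors then fixes `S` completely. -/
theorem theorem6p6 (K : Type w) [Field K] [CharZero K] :
    (∀ (𝔤 : LInfinityAlgebra.{w, u} K) (V : GradedSpace.{w, v} K) (r : 𝔤.Representation V)
      (Θ : V.T →ₗ[K] 𝔤.space), r.IsHomotopyEmbeddingTensor Θ →
        PointwiseFinite (fun n => r.adPow Θ 1 n r.hemisemidirect) ∧
        r.total.IsMaurerCartan (r.expAd Θ 1 r.hemisemidirect) ∧
        (∀ X : V.T, r.expAd Θ 1 r.hemisemidirect (tmap (LinearMap.inr K 𝔤.space V) X) =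
          LinearMap.inr K 𝔤.space V (r.twist Θ X)) ∧
        V.IsMaurerCartan (r.twist Θ)) ∧
    ∃ (hobj : ∀ A : HomotopyEmbeddingTensor.{w, u, v} K, A.space.IsMaurerCartan (A.rep.twist A.Θ))
      (hdeg : ∀ (A B : HomotopyEmbeddingTensor.{w, u, v} K) (φ : A ⟶ B),
        IsCochain A.space B.space 0 (φ.φV ∘ₗ TensorAlgebra.ιInv))
      (hmap : ∀ (A B : HomotopyEmbeddingTensor.{w, u, v} K) (φ : A ⟶ B),
        (φ.φV ∘ₗ TensorAlgebra.ιInv) ∘ₗ A.space.insertion 1 (A.rep.twist A.Θ) =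
          B.rep.twist B.Θ ∘ₗ barMap (φ.φV ∘ₗ TensorAlgebra.ιInv))
      (S : HomotopyEmbeddingTensor.{w, u, v} K ⥤ LeibnizInfinityAlgebra.{w, v} K),
      S.toPrefunctor =
        { obj := fun A => ⟨A.space, A.rep.twist A.Θ, hobj A⟩
          map := fun {A B} φ => ⟨φ.φV ∘ₗ TensorAlgebra.ιInv, hdeg A B φ, hmap A B φ⟩ } := by
  refine ⟨fun 𝔤 V r Θ hΘ => ⟨r.pointwiseFinite_adPow hΘ.isCochain,
    r.isMaurerCartan_expAd hΘ.isCochain, r.expAd_inclMod hΘ, r.isMaurerCartan_twist hΘ⟩, ?_⟩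
  have hobj (A : HomotopyEmbeddingTensor.{w, u, v} K) :=
    A.rep.isMaurerCartan_twist A.isHomotopyEmbeddingTensor
  have hdeg (A B : HomotopyEmbeddingTensor.{w, u, v} K) (φ : A ⟶ B) :
      IsCochain A.space B.space 0 (φ.φV ∘ₗ TensorAlgebra.ιInv) :=
    isCochain_comp_ιInv φ.φV_degree
  have hmap (A B : HomotopyEmbeddingTensor.{w, u, v} K) (φ : A ⟶ B) :
      (φ.φV ∘ₗ TensorAlgebra.ιInv) ∘ₗ A.space.insertion 1 (A.rep.twist A.Θ) =
        B.rep.twist B.Θ ∘ₗ barMap (φ.φV ∘ₗ TensorAlgebra.ιInv) := by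
    ext X
    simp only [LinearMap.comp_apply]
    -- For a linear homomorphism the defining identity reduces to `φV ∘ θ = θ' ∘ T(φV)`.
    rw [ιInv_insertion (hobj A).isCochain.map_one, barMap_comp_ιInv,
      HomotopyEmbeddingTensor.Hom.map_twist]
  refine ⟨hobj, hdeg, hmap,
    { obj := fun A => ⟨A.space, A.rep.twist A.Θ, hobj A⟩
      map := fun {A B} φ => ⟨φ.φV ∘ₗ TensorAlgebra.ιInv, hdeg A B φ, hmap A B φ⟩
      map_id := fun A => LeibnizInfinityAlgebra.Hom.ext (LinearMap.id_comp _)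
      map_comp := fun {A B C} f g =>
        LeibnizInfinityAlgebra.Hom.ext (LinearMap.ext fun X => ?_) }, rfl⟩
  -- The composite homomorphism passes through `barMap` of the first map, whose corestriction to
  -- letters is that map again.
  change g.φV (f.φV (TensorAlgebra.ιInv X)) =
    g.φV (TensorAlgebra.ιInv (barMap (f.φV ∘ₗ TensorAlgebra.ιInv) X))
  rw [ιInv_barMap (hdeg A B f).map_one, LinearMap.comp_apply]
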